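/- Graphs are finite and undirected and may have loops and multiple edges. For a connected graph $H$ let $\beta(H)=|E(H)|-|V(H)|+1$ be its Betti number, and let its maximum genus $\gamma_M(H)$ be the largest integer $k$ such that $H$ has a cellular embedding in the orientable closed surface of genus $k$, cellular embeddings being described combinatorially by rotation systems: a cyclic order of the half-edges at each vertex, whose faces are the orbits of face tracing, with the genus $k$ given by Euler's formula $|V(H)|-|E(H)|+|F|=2-2k$ (the one-vertex graph without edges has one face). $H$ is upper-embeddable if $\gamma_M(H)=\lfloor \beta(H)/2\rfloor$. Let $G$ be a connected graph and let $A$ be an edge-cut of $G$, that is, the set of all edges joining $S$ to $V(G)\setminus S$ for some $\emptyset\ne S\subsetneq V(G)$, such that $G-A$ has exactly two components $G_1$ and $G_2$. If both $G_1$ and $G_2$ are upper-embeddable, then $\gamma_M(G)\ge\lfloor \beta(G)/2\rfloor-1$. Furthermore, $G$ is upper-embeddable if one of the following conditions holds: (1) $\beta(G_1)\equiv\beta(G_2)\equiv 0 \pmod 2$; (2) $|A|\equiv 1\pmod 2$ and $\beta(G_1)+\beta(G_2)\equiv 1\pmod 2$. -/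

import Mathlib

open scoped Graph

namespace Graph

variable {α β : Type*}

/-- A multigraph (loops and parallel edges allowed) is connected if it has a vertex and any two
vertices are joined by a walk. -/
def IsConnected (G : Graph α β) : Prop :=
  V(G).Nonempty ∧ ∀ ⦃x⦄, x ∈ V(G) → ∀ ⦃y⦄, y ∈ V(G) → Relation.ReflTransGen G.Adj x y

/-- A component of `G` is a maximal connected subgraph of `G`. -/
def IsComponent (H G : Graph α β) : Prop :=
  Maximal (fun K : Graph α β => K ≤ G ∧ K.IsConnected) H

/-- An edge-cut of `G`: the set of all edges joining `S` to `V(G) \ S`, where `S` is a nonempty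
proper subset of the vertex set. -/
def IsEdgeCut (G : Graph α β) (A : Set β) : Prop :=
  ∃ S : Set α, S ⊆ V(G) ∧ S.Nonempty ∧ (V(G) \ S).Nonempty ∧
    A = {e | ∃ x ∈ S, ∃ y ∈ V(G) \ S, G.IsLink e x y}

/-- The Betti number `|E(G)| - |V(G)| + 1` (for finite connected `G`). -/
noncomputable def betti (G : Graph α β) : ℤ :=
  (E(G).ncard : ℤ) - (V(G).ncard : ℤ) + 1

/-- The half-edges (darts) of `G`: every edge, loops included, has exactly two. -/
abbrev Dart (G : Graph α β) : Type _ := E(G) × Bool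

/-- The involution that exchanges the two half-edges of each edge. -/
def dartRev (G : Graph α β) : Equiv.Perm G.Dart :=
  (Equiv.refl E(G)).prodCongr Equiv.boolNot

/-- A rotation system of `G`, that is, a cellular embedding of the connected graph `G` in an
oriented closed surface, up to orientation-preserving homeomorphism. The function `tail` attaches
the two half-edges of every edge to its two ends, and `rot` permutes the half-edges so that its
cycles are the cyclic orders in which the half-edges at the individual vertices leave the vertex
in the positive direction. -/
structure RotationSystem (G : Graph α β) where
  /-- the vertex to which a half-edge is attached -/
  tail : G.Dart → α
  /-- the two half-edges of an edge are attached to its two ends -/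
  isLink_tail : ∀ e : E(G), G.IsLink e (tail (e, false)) (tail (e, true))
  /-- the next half-edge in the rotation at the same vertex -/
  rot : Equiv.Perm G.Dart
  /-- the half-edges at each vertex form a single cycle of `rot` -/
  sameCycle_rot_iff : ∀ d d' : G.Dart, rot.SameCycle d d' ↔ tail d = tail d'

namespace RotationSystem

variable {G : Graph α β}

/-- Face tracing: go along the half-edge `d` to the other end of its edge and leave that vertex by
the next half-edge in the rotation there. -/
def facePerm (R : G.RotationSystem) : Equiv.Perm G.Dart :=
  R.rot * G.dartRev

/-- The faces: the orbits of face tracing, together with one face around every vertex without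
half-edges (for connected `G` this concerns only the one-vertex graph without edges, embedded in
the sphere with one face). -/
def Face (R : G.RotationSystem) : Type _ :=
  Quotient (Equiv.Perm.SameCycle.setoid R.facePerm) ⊕ {v : V(G) // ∀ d, R.tail d ≠ v}

/-- The embedding of the connected graph `G` is in the orientable surface of genus `k`, by Euler's
formula `|V| - |E| + |F| = 2 - 2k`. -/
def HasGenus (R : G.RotationSystem) (k : ℕ) : Prop :=
  (V(G).ncard : ℤ) - (E(G).ncard : ℤ) + (Nat.card R.Face : ℤ) = 2 - 2 * (k : ℤ)

end RotationSystem

/-- `g` is the maximum genus of the connected graph `G`: the largest `k` such that `G` has a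
cellular embedding in the orientable surface of genus `k`. -/
def IsMaxGenus (G : Graph α β) (g : ℕ) : Prop :=
  IsGreatest {k : ℕ | ∃ R : G.RotationSystem, R.HasGenus k} g

/-- `G` is upper-embeddable: its maximum genus equals `⌊β(G) / 2⌋`. -/
def UpperEmbeddable (G : Graph α β) : Prop :=
  ∃ g : ℕ, G.IsMaxGenus g ∧ (g : ℤ) = G.betti / 2

end Graph

/-! By Euler's formula an embedding of genus `k` has `β - 2k + 1` faces, so maximum genus means
fewest faces, and a graph is upper-embeddable iff some rotation system has one face (`β` even) or
two faces (`β` odd). The core is a gluing result: rotation systems of `G₁` and `G₂` with `F₁` and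
`F₂` faces extend over the cut `A` to one of `G` with `F ≤ F₁ + F₂` faces. As `F₁ + F₂ ≤ 4` and `F ≡
β(G) + 1` modulo 2 (`even_card_add_card_add_numFaces`), the general bound follows. In case (1), `F ≤
2`. In case (2), `F ≤ 3`, and `β(G) = β(G₁) + β(G₂) + |A| - 1` is odd, so `F` is even and again `F ≤
2`.

Gluing rests on `exists_isRotation_union`: edges `A` between a vertex set `W` and its complement can
be added to a rotation system of edges `S`, none of which crosses, without raising the face count.
An inserted edge merges two faces or splits one (`exists_insert`). After a split its end has corners
on both new faces, so a second edge there can merge again: two adjacent edges can be inserted at no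
net cost.

The induction is on `|W| + |S| + |A|`. An edge of `S` with different faces on its sides is set
aside: its deletion gains what its reinsertion may cost. If every edge has one face on both sides,
take a shortest face walk inside `W` from one side of an edge `e` to the other. The next edge `f` on
it is adjacent to `e`, and deleting both leaves the face count unchanged
(`exists_erase_erase_or_leaf`), so the pair is set aside; failing this, `W` has a leaf. A leaf or an
isolated vertex is moved out of `W`, unless it meets two edges of `A`, which are then set aside as a
pair. -/

namespace Equiv.Perm

/-! ### Orbits of a permutation and their change under a transposition. -/

variable {X Y : Type*}

/-- The number of orbits of a permutation. -/
noncomputable def numOrbits (π : Perm X) : ℕ := Nat.card (Quotient (SameCycle.setoid π))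

theorem SameCycle.eq_of_invariant {π : Perm X} {f : X → Y} (hf : ∀ x, f (π x) = f x) {x y : X}
    (h : π.SameCycle x y) : f x = f y := by
  obtain ⟨n, rfl⟩ := h
  have hi : ∀ x, f (π⁻¹ x) = f x := fun x => by
    have := hf (π⁻¹ x)
    rwa [← Perm.mul_apply, mul_inv_cancel, Perm.one_apply, eq_comm] at this
  induction n using Int.induction_on with
  | zero => simp
  | succ n ih => rw [add_comm, zpow_add, zpow_one, Perm.mul_apply, hf]; exact ih
  | pred n ih => rw [sub_eq_neg_add, zpow_add, zpow_neg_one, Perm.mul_apply, hi]; exact ih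

theorem SameCycle.mem_of_mapsTo [Finite X] {π : Perm X} {Z : Set X} (hZ : ∀ x ∈ Z, π x ∈ Z)
    {x y : X} (h : π.SameCycle x y) (hx : x ∈ Z) : y ∈ Z := by
  obtain ⟨n, rfl⟩ := h.exists_nat_pow_eq
  induction n with
  | zero => simpa using hx
  | succ n ih => rw [pow_succ', Perm.mul_apply]; exact hZ _ (ih ⟨n, by simp⟩)

theorem sameCycle_apply (π : Perm X) (x : X) : π.SameCycle x (π x) :=
  sameCycle_apply_right.2 (SameCycle.refl _ _)

theorem sameCycle_of_apply_eq {π : Perm X} {x y : X} (h : π x = y) : π.SameCycle x y :=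
  h ▸ sameCycle_apply π x

theorem numOrbits_one : (1 : Perm X).numOrbits = Nat.card X := by
  refine (Nat.card_congr (Equiv.ofBijective (Quotient.mk (SameCycle.setoid (1 : Perm X)))
    ⟨fun x y h => ?_, Quotient.mk_surjective⟩)).symm
  exact sameCycle_one.1 (Quotient.exact h)

variable [DecidableEq X]

theorem sameCycle_or_sameCycle_mul_swap [Finite X] (π : Perm X) (a b : X) :
    π.SameCycle a b ∨ (π * swap a b).SameCycle a b := by
  by_contra! h
  obtain ⟨h₁, h₂⟩ := h
  have hab : a ≠ b := by rintro rfl; exact h₁ (SameCycle.refl _ _)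
  -- The product sends `a` to `π b` and then follows the `π`-cycle of `b`, which avoids `a`, until
  -- it arrives at `b`.
  have key : ∀ n : ℕ, (π * swap a b).SameCycle a ((π ^ (n + 1)) b) := by
    intro n
    induction n with
    | zero => exact sameCycle_of_apply_eq (by simp)
    | succ n ih =>
      have h3 : (π ^ (n + 1)) b ≠ b := fun h => h₂ (by rwa [h] at ih)
      have h4 : (π ^ (n + 1)) b ≠ a := fun h =>
        h₁ (SameCycle.symm ⟨(n + 1 : ℕ), by rwa [zpow_natCast]⟩)
      refine ih.trans (sameCycle_of_apply_eq ?_)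
      rw [Perm.mul_apply, swap_apply_of_ne_of_ne h4 h3, ← Perm.mul_apply, ← pow_succ']
  have h5 := key (orderOf π - 1)
  rw [Nat.sub_add_cancel (orderOf_pos π), pow_orderOf_eq_one] at h5
  exact h₂ h5

theorem not_sameCycle_mul_swap [Finite X] {π : Perm X} {a b : X} (hab : a ≠ b)
    (h : π.SameCycle a b) : ¬ (π * swap a b).SameCycle a b := by
  classical
  intro h'
  have hex : ∃ k : ℕ, (π ^ (k + 1)) b = a := by
    obtain ⟨n, h0, -, hn⟩ := h.symm.exists_pow_eq''
    exact ⟨n - 1, by rwa [Nat.sub_add_cancel h0]⟩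
  set k := Nat.find hex with hk
  have hka := Nat.find_spec hex
  rw [← hk] at hka
  -- The segment `π b, ..., a` is closed under the product, which sends `a` back to `π b`. By
  -- minimality of `k` it does not contain `b`.
  let Z : Set X := {x | ∃ i ≤ k, (π ^ (i + 1)) b = x}
  have hb : ∀ i ≤ k, (π ^ (i + 1)) b ≠ b := by
    intro i hi hib
    have hik : i ≠ k := by rintro rfl; exact hab (hka.symm.trans hib)
    have hlt : k - (i + 1) < k := by omega
    refine Nat.find_min hex (hk ▸ hlt) ?_
    have : (π ^ (k - (i + 1) + 1)) ((π ^ (i + 1)) b) = a := by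
      rw [← Perm.mul_apply, ← pow_add, ← hka]
      congr 2
      omega
    rwa [hib] at this
  have hZ : ∀ x ∈ Z, (π * swap a b) x ∈ Z := by
    rintro x ⟨i, hi, rfl⟩
    by_cases hia : (π ^ (i + 1)) b = a
    · exact ⟨0, by omega, by simp [hia]⟩
    · have hik : i ≠ k := by rintro rfl; exact hia hka
      refine ⟨i + 1, by omega, ?_⟩
      rw [Perm.mul_apply, swap_apply_of_ne_of_ne hia (hb i hi), ← Perm.mul_apply, ← pow_succ']
  obtain ⟨i, hi, hib⟩ := h'.mem_of_mapsTo hZ ⟨k, le_rfl, hka⟩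
  exact hb i hi hib

theorem sameCycle_mul_swap_iff [Finite X] {π : Perm X} {a b : X} (hab : a ≠ b) :
    (π * swap a b).SameCycle a b ↔ ¬ π.SameCycle a b :=
  ⟨fun h h' => not_sameCycle_mul_swap hab h' h,
    (sameCycle_or_sameCycle_mul_swap π a b).resolve_left⟩

theorem SameCycle.mul_swap [Finite X] {π : Perm X} {a b : X} (h : ¬ π.SameCycle a b) {x y : X}
    (hxy : π.SameCycle x y) : (π * swap a b).SameCycle x y := by
  have hab := (sameCycle_or_sameCycle_mul_swap π a b).resolve_left h
  have := hxy.eq_of_invariant (Y := Quotient (SameCycle.setoid (π * swap a b))) (f := Quotient.mk _)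
    fun x => Quotient.sound ?_
  · exact Quotient.exact this
  change (π * swap a b).SameCycle _ _
  by_cases hxa : x = a
  · subst hxa
    exact (sameCycle_of_apply_eq (by simp : (π * swap x b) b = π x)).symm.trans hab.symm
  · by_cases hxb : x = b
    · subst hxb
      exact (sameCycle_of_apply_eq (by simp : (π * swap a x) a = π x)).symm.trans hab
    · exact (sameCycle_of_apply_eq (by simp [swap_apply_of_ne_of_ne hxa hxb])).symm

/-- Collapsing the classes of `a` and `b` to one makes orbits of `π` invariant under
`π * swap a b`. -/
theorem SameCycle.collapse_mul_swap {π : Perm X} {a b x y : X}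
    (hxy : (π * swap a b).SameCycle x y) (hx : ¬ π.SameCycle b x) (hy : ¬ π.SameCycle b y) :
    π.SameCycle x y := by
  classical
  let f : X → Quotient (SameCycle.setoid π) := fun x =>
    if π.SameCycle b x then Quotient.mk _ a else Quotient.mk _ x
  have hf : ∀ x, f (π x) = f x := by
    intro x
    have h1 : π.SameCycle b (π x) ↔ π.SameCycle b x := sameCycle_apply_right
    have h2 : (Quotient.mk (SameCycle.setoid π) (π x)) = Quotient.mk _ x :=
      Quotient.sound (sameCycle_apply π x).symm
    simp only [f, h1, h2]
  have hfa : f a = Quotient.mk _ a := by simp [f]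
  have hfb : f b = Quotient.mk _ a := by simp [f, SameCycle.refl]
  have := hxy.eq_of_invariant (f := f) ?_
  · simp only [f, hx, hy, if_false] at this
    exact Quotient.exact this
  intro x
  rw [Perm.mul_apply, hf]
  by_cases hxa : x = a
  · subst hxa; rw [swap_apply_left, hfa, hfb]
  · by_cases hxb : x = b
    · subst hxb; rw [swap_apply_right, hfa, hfb]
    · rw [swap_apply_of_ne_of_ne hxa hxb]

/-- The cycles of `a` and `b` merge and the others survive, so the orbits of `π` other than that of
`b` represent the new orbits bijectively. -/
theorem numOrbits_mul_swap_of_not_sameCycle [Finite X] {π : Perm X} {a b : X}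
    (h : ¬ π.SameCycle a b) : (π * swap a b).numOrbits + 1 = π.numOrbits := by
  classical
  have hab' := (sameCycle_or_sameCycle_mul_swap π a b).resolve_left h
  let Q := Quotient (SameCycle.setoid π)
  let Q' := Quotient (SameCycle.setoid (π * swap a b))
  let q : Q → Q' := Quotient.map id fun x y hxy => SameCycle.mul_swap h hxy
  let qb : Q := Quotient.mk _ b
  have hbij : Function.Bijective (fun z : {z : Q // z ≠ qb} => q z.1) := by
    constructor
    · rintro ⟨⟨x⟩, hx⟩ ⟨⟨y⟩, hy⟩ hxy
      have hxy' : (π * swap a b).SameCycle x y := Quotient.exact hxy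
      refine Subtype.ext (Quotient.sound (hxy'.collapse_mul_swap ?_ ?_))
      · exact fun hb => hx (Quotient.sound hb.symm)
      · exact fun hb => hy (Quotient.sound hb.symm)
    · rintro ⟨y⟩
      by_cases hy : π.SameCycle b y
      · refine ⟨⟨Quotient.mk _ a, fun hq => h (Quotient.exact hq)⟩, Quotient.sound ?_⟩
        exact hab'.trans (SameCycle.mul_swap h hy)
      · exact ⟨⟨Quotient.mk _ y, fun hq => hy (Quotient.exact hq).symm⟩, rfl⟩
  have h1 : Nat.card {z : Q // z ≠ qb} = Nat.card Q' := Nat.card_eq_of_bijective _ hbij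
  have h2 : Nat.card {z : Q // z ≠ qb} + 1 = Nat.card Q := by
    rw [← Finite.card_option]
    exact Nat.card_congr (Equiv.optionSubtypeNe qb)
  rw [h1] at h2
  exact h2

theorem numOrbits_mul_swap_of_sameCycle [Finite X] {π : Perm X} {a b : X} (hab : a ≠ b)
    (h : π.SameCycle a b) : (π * swap a b).numOrbits = π.numOrbits + 1 := by
  have := numOrbits_mul_swap_of_not_sameCycle (not_sameCycle_mul_swap hab h)
  rw [mul_assoc, swap_mul_self, mul_one] at this
  exact this.symm

theorem sign_eq_neg_one_pow_numOrbits [Fintype X] (π : Perm X) :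
    sign π = (-1) ^ (Fintype.card X + π.numOrbits) := by
  induction π using swap_induction_on' with
  | one => rw [numOrbits_one, Nat.card_eq_fintype_card, ← two_mul]; simp
  | mul_swap π a b hab ih =>
    rw [sign_mul, sign_swap hab, ih]
    by_cases h : π.SameCycle a b
    · rw [numOrbits_mul_swap_of_sameCycle hab h, ← add_assoc, pow_succ]
    · rw [← numOrbits_mul_swap_of_not_sameCycle h, ← add_assoc, pow_succ]
      simp

/-- Taking the point `x` out of its cycle. -/
def erasePoint (π : Perm X) (x : X) : Perm X := π * swap (π⁻¹ x) x

theorem erasePoint_eq (π : Perm X) (x : X) : π.erasePoint x = swap x (π x) * π := by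
  rw [erasePoint, Equiv.mul_swap_eq_swap_mul, ← Perm.mul_apply, mul_inv_cancel, Perm.one_apply]

theorem erasePoint_self (π : Perm X) (x : X) : π.erasePoint x x = x := by simp [erasePoint]

theorem erasePoint_apply_of_ne (π : Perm X) {x y : X} (hy : y ≠ x) (h : π y ≠ x) :
    π.erasePoint x y = π y := by
  rw [erasePoint_eq, Perm.mul_apply, swap_apply_of_ne_of_ne h (fun h' => hy (π.injective h'))]

theorem erasePoint_apply_of_eq (π : Perm X) {x y : X} (h : π y = x) :
    π.erasePoint x y = π x := by
  rw [erasePoint_eq, Perm.mul_apply, h, swap_apply_left]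

theorem SameCycle.erasePoint [Finite X] {π : Perm X} {x y z : X} (hy : y ≠ x) (hz : z ≠ x)
    (h : π.SameCycle y z) : (π.erasePoint x).SameCycle y z := by
  have h1 : π = π.erasePoint x * swap (π⁻¹ x) x := by simp [Perm.erasePoint, mul_assoc]
  rw [h1] at h
  have hfix : Function.IsFixedPt (π.erasePoint x) x := erasePoint_self π x
  exact h.collapse_mul_swap (fun h' => hy (h'.eq_of_left hfix).symm)
    (fun h' => hz (h'.eq_of_left hfix).symm)

end Equiv.Perm

/-! ### Rotation systems on a varying edge set, with a marker at each vertex. -/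

open Equiv Equiv.Perm

/-- The half-edges of a graph with edge set `E` and vertex set `V`, together with one marker
for every vertex. The marker turns an isolated vertex into a face orbit of its own. -/
abbrev MarkedDart (E V : Type*) : Type _ := (E × Bool) ⊕ V

namespace MarkedDart

variable {E V : Type*}

/-- The vertex at which a half-edge or marker sits. -/
def vert (t : E × Bool → V) : MarkedDart E V → V := Sum.elim t id

@[simp] theorem vert_inl (t : E × Bool → V) (d : E × Bool) : vert t (.inl d) = t d := rfl
@[simp] theorem vert_inr (t : E × Bool → V) (v : V) : vert t (.inr v) = v := rfl

theorem vert_swap [DecidableEq (MarkedDart E V)] {t : E × Bool → V} {a b : MarkedDart E V}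
    (h : vert t a = vert t b) (x : MarkedDart E V) : vert t (swap a b x) = vert t x := by
  rw [swap_apply_def]
  split_ifs with h₁ h₂
  · rw [h₁, h]
  · rw [h₂, h]
  · rfl

/-- `x` is a marker or a half-edge of an edge in `S`. -/
def Active (S : Finset E) (x : MarkedDart E V) : Prop := ∀ e b, x = .inl (e, b) → e ∈ S

theorem active_inr (S : Finset E) (v : V) : Active S (.inr v : MarkedDart E V) := by
  rintro e b ⟨⟩

theorem active_inl {S : Finset E} {e : E} (h : e ∈ S) (b : Bool) :
    Active S (.inl (e, b) : MarkedDart E V) := by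
  rintro f b' ⟨⟩; exact h

theorem Active.ne {S : Finset E} {x : MarkedDart E V} (h : Active S x) {e : E} (he : e ∉ S)
    (b : Bool) : x ≠ .inl (e, b) := fun h' => he (h e b h')

/-- `ρ` is a rotation system of the graph with the edges in `S`, whose half-edges are attached by
`t`: its cycles are the sets of half-edges at the individual vertices, each with the marker of the
vertex put in, and the half-edges of the other edges are fixed. -/
structure IsRotation (t : E × Bool → V) (S : Finset E) (ρ : Perm (MarkedDart E V)) : Prop where
  fixed : ∀ e ∉ S, ∀ b, ρ (.inl (e, b)) = .inl (e, b)
  vert_apply : ∀ x, vert t (ρ x) = vert t x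
  sameCycle : ∀ e ∈ S, ∀ b, ρ.SameCycle (.inl (e, b)) (.inr (t (e, b)))

variable {t : E × Bool → V} {S : Finset E} {ρ : Perm (MarkedDart E V)}

theorem IsRotation.sameCycle_marker (h : IsRotation t S ρ) {x : MarkedDart E V}
    (hx : Active S x) : ρ.SameCycle x (.inr (vert t x)) := by
  rcases x with ⟨e, b⟩ | v
  · exact h.sameCycle e (hx e b rfl) b
  · exact SameCycle.refl _ _

theorem IsRotation.apply_ne (h : IsRotation t S ρ) {e : E} (he : e ∈ S) (b : Bool) :
    ρ (.inl (e, b)) ≠ .inl (e, b) := fun h' => by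
  cases (h.sameCycle e he b).eq_of_left h'

variable [DecidableEq E]

/-- Exchange the two half-edges of every edge in `S`. -/
def flip (S : Finset E) : Perm (MarkedDart E V) :=
  Function.Involutive.toPerm
    (fun x => match x with
      | .inl (e, b) => if e ∈ S then .inl (e, !b) else .inl (e, b)
      | .inr v => .inr v)
    (by
      rintro (⟨e, b⟩ | v)
      · by_cases h : e ∈ S <;> simp [h]
      · rfl)

@[simp] theorem flip_inr (S : Finset E) (v : V) : flip S (.inr v) = (.inr v : MarkedDart E V) := rfl

theorem flip_of_mem {S : Finset E} {e : E} (h : e ∈ S) (b : Bool) :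
    flip S (.inl (e, b)) = (.inl (e, !b) : MarkedDart E V) := if_pos h

theorem flip_of_notMem {S : Finset E} {e : E} (h : e ∉ S) (b : Bool) :
    flip S (.inl (e, b)) = (.inl (e, b) : MarkedDart E V) := if_neg h

theorem flip_flip (S : Finset E) (x : MarkedDart E V) : flip S (flip S x) = x :=
  (flip S).symm_apply_apply x

theorem flip_insert [DecidableEq V] {S : Finset E} {e : E} (he : e ∉ S) (b : Bool) :
    flip (insert e S) = flip S * swap (.inl (e, b) : MarkedDart E V) (.inl (e, !b)) := by
  ext1 x
  rw [Perm.mul_apply]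
  rcases x with ⟨f, b'⟩ | v
  · by_cases hf : f = e
    · subst hf
      rw [flip_of_mem (Finset.mem_insert_self _ _)]
      by_cases hb : b' = b
      · subst hb
        rw [swap_apply_left, flip_of_notMem he]
      · replace hb : b' = !b := Bool.eq_not.2 hb
        subst hb
        rw [swap_apply_right, flip_of_notMem he, Bool.not_not]
    · rw [swap_apply_of_ne_of_ne (by simp [hf]) (by simp [hf])]
      by_cases hS : f ∈ S
      · rw [flip_of_mem hS, flip_of_mem (Finset.mem_insert_of_mem hS)]
      · rw [flip_of_notMem hS, flip_of_notMem (by simp [hf, hS])]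
  · rw [swap_apply_of_ne_of_ne (by simp) (by simp)]
    rfl

/-- The face permutation. -/
def face (S : Finset E) (ρ : Perm (MarkedDart E V)) : Perm (MarkedDart E V) := ρ * flip S

/-- The number of faces of `ρ` plus twice the number of all edges, those outside `S` included. -/
noncomputable def faceCount (S : Finset E) (ρ : Perm (MarkedDart E V)) : ℕ :=
  (face S ρ).numOrbits + 2 * S.card

theorem face_apply (S : Finset E) (ρ : Perm (MarkedDart E V)) (x : MarkedDart E V) :
    face S ρ x = ρ (flip S x) := rfl

theorem IsRotation.face_fixed (h : IsRotation t S ρ) {e : E} (he : e ∉ S) (b : Bool) :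
    face S ρ (.inl (e, b)) = .inl (e, b) := by
  rw [face_apply, flip_of_notMem he, h.fixed e he]

theorem flip_erase [DecidableEq V] {S : Finset E} {e : E} (he : e ∈ S) (b : Bool) :
    flip S = flip (S.erase e) * swap (.inl (e, b) : MarkedDart E V) (.inl (e, !b)) := by
  rw [← flip_insert (Finset.notMem_erase e S), Finset.insert_erase he]

/-- The rotation that is left when the edge `e` with half-edges `(e, b)` and `(e, !b)` is
deleted. -/
def eraseEdge [DecidableEq V] (ρ : Perm (MarkedDart E V)) (e : E) (b : Bool) :
    Perm (MarkedDart E V) :=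
  (ρ.erasePoint (.inl (e, b))).erasePoint (.inl (e, !b))

theorem eraseEdge_apply_of_ne [DecidableEq V] (ρ : Perm (MarkedDart E V)) {e : E} {b : Bool}
    {x : MarkedDart E V} (h₀ : x ≠ .inl (e, b)) (h₁ : x ≠ .inl (e, !b))
    (h₂ : ρ x ≠ .inl (e, b)) (h₃ : ρ x ≠ .inl (e, !b)) : eraseEdge ρ e b x = ρ x := by
  have h := erasePoint_apply_of_ne ρ h₀ h₂
  rw [eraseEdge, erasePoint_apply_of_ne _ h₁ (by rwa [h]), h]

theorem eraseEdge_apply_of_eq [DecidableEq V] (ρ : Perm (MarkedDart E V)) {e : E} {b : Bool}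
    {x : MarkedDart E V} (h₀ : x ≠ .inl (e, b)) (h : ρ x = .inl (e, !b))
    (h₁ : ρ (.inl (e, !b)) ≠ .inl (e, b)) : eraseEdge ρ e b x = ρ (.inl (e, !b)) := by
  rw [eraseEdge, erasePoint_apply_of_eq, erasePoint_apply_of_ne _ (by simp) h₁]
  rw [erasePoint_apply_of_ne _ h₀ (by simp [h]), h]

/-! ### The face count under insertion and deletion of an edge. -/

variable [Finite E] [Finite V]

/-- The corner behind `c` lies on the face of `flip S c`, since `face` sends `flip S c` to `ρ c`.
The new edge runs from this corner to the one behind the marker of its other end; it merges the two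
faces if they differ and splits the face if they agree. The last clause feeds the next insertion:
after a split, the vertex `t (e, b)` has a corner off any prescribed face. -/
theorem IsRotation.exists_insert (h : IsRotation t S ρ) {e : E} (he : e ∉ S) (b : Bool)
    {c : MarkedDart E V} (hc : Active S c) (hct : vert t c = t (e, b)) :
    ∃ ρ', IsRotation t (insert e S) ρ' ∧
      ((¬ (face S ρ).SameCycle (flip S c) (.inr (t (e, !b))) ∧
          faceCount (insert e S) ρ' + 1 = faceCount S ρ) ∨
        ((face S ρ).SameCycle (flip S c) (.inr (t (e, !b))) ∧
          faceCount (insert e S) ρ' = faceCount S ρ + 1 ∧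
          ∀ z, ∃ c', Active (insert e S) c' ∧ vert t c' = t (e, b) ∧
            ¬ (face (insert e S) ρ').SameCycle (flip (insert e S) c') z)) := by
  classical
  set x₀ : MarkedDart E V := .inl (e, b) with hx₀
  set x₁ : MarkedDart E V := .inl (e, !b) with hx₁
  set d : MarkedDart E V := .inr (t (e, !b)) with hd
  -- As `x₀` is a fixed point of `ρ`, this puts it directly behind `c` in its cycle; likewise `x₁`
  -- goes behind `d`.
  set ρ₁ := ρ * swap c x₀ with hρ₁
  set ρ' := ρ₁ * swap d x₁ with hρ'
  have h01 : x₀ ≠ x₁ := by simp [hx₀, hx₁]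
  have hc0 : c ≠ x₀ := hc.ne he b
  have hc1 : c ≠ x₁ := hc.ne he _
  have hd1 : d ≠ x₁ := by simp [hd, hx₁]
  have hd0 : d ≠ x₀ := by simp [hd, hx₀]
  have f0 : ρ x₀ = x₀ := h.fixed e he b
  have f1 : ρ x₁ = x₁ := h.fixed e he _
  have n0 : ¬ ρ.SameCycle c x₀ := fun h' => hc0 (h'.eq_of_right f0)
  have g1 : ρ₁ x₁ = x₁ := by rw [hρ₁, Perm.mul_apply, swap_apply_of_ne_of_ne hc1.symm h01.symm, f1]
  have n1 : ¬ ρ₁.SameCycle d x₁ := fun h' => hd1 (h'.eq_of_right g1)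
  have hrot : IsRotation t (insert e S) ρ' := by
    refine ⟨fun f hf b' => ?_, fun x => ?_, fun f hf b' => ?_⟩
    · have hfe : f ≠ e := fun h' => hf (h' ▸ Finset.mem_insert_self _ _)
      have hfS : f ∉ S := fun h' => hf (Finset.mem_insert_of_mem h')
      have k1 : swap d x₁ (.inl (f, b')) = .inl (f, b') :=
        swap_apply_of_ne_of_ne (by simp [hd]) (by simp [hx₁, hfe])
      have k0 : swap c x₀ (.inl (f, b')) = .inl (f, b') :=
        swap_apply_of_ne_of_ne (hc.ne hfS b').symm (by simp [hx₀, hfe])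
      rw [hρ', hρ₁, Perm.mul_apply, Perm.mul_apply, k1, k0, h.fixed f hfS]
    · rw [hρ', hρ₁, Perm.mul_apply, Perm.mul_apply, h.vert_apply, vert_swap hct,
        vert_swap (by simp [hd, hx₁])]
    · by_cases hfe : f = e
      · subst hfe
        by_cases hb : b' = b
        · subst hb
          refine SameCycle.mul_swap n1 ?_
          refine ((sameCycle_or_sameCycle_mul_swap ρ c x₀).resolve_left n0).symm.trans ?_
          rw [← hct]
          exact SameCycle.mul_swap n0 (h.sameCycle_marker hc)
        · replace hb : b' = !b := Bool.eq_not.2 hb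
          subst hb
          exact ((sameCycle_or_sameCycle_mul_swap ρ₁ d x₁).resolve_left n1).symm
      · exact SameCycle.mul_swap n1 (SameCycle.mul_swap n0
          (h.sameCycle f ((Finset.mem_insert.1 hf).resolve_left hfe) b'))
  set φ := face S ρ with hφ
  set c' := flip S c with hc'
  have hcc : flip S c' = c := flip_flip S c
  have F0 : flip S x₀ = x₀ := flip_of_notMem he b
  have F1 : flip S x₁ = x₁ := flip_of_notMem he _
  have hc'0 : c' ≠ x₀ := fun h' => hc0 (by rw [← hcc, h', F0])
  have hc'1 : c' ≠ x₁ := fun h' => hc1 (by rw [← hcc, h', F1])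
  set φ₁ := φ * swap c' x₀ with hφ₁
  set φ₂ := φ₁ * swap d x₁ with hφ₂
  -- The first two transpositions only attach the fixed points `x₀` and `x₁` to the faces of `c'`
  -- and `d`. The last one, `swap x₀ x₁`, decides between merging and splitting.
  have hface : face (insert e S) ρ' = φ₂ * swap x₀ x₁ := by
    have e1 : swap d x₁ * flip S = flip S * swap d x₁ := by
      rw [Equiv.mul_swap_eq_swap_mul, F1]; rfl
    have e0 : swap c x₀ * flip S = flip S * swap c' x₀ := by
      rw [Equiv.mul_swap_eq_swap_mul, F0, hcc]
    rw [face, flip_insert he b, hρ', hρ₁, hφ₂, hφ₁, hφ, face]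
    simp only [mul_assoc]
    rw [← mul_assoc (swap d x₁) (flip S), e1, mul_assoc, ← mul_assoc (swap c x₀) (flip S), e0]
    simp only [mul_assoc]
    rfl
  have p0 : φ x₀ = x₀ := h.face_fixed he b
  have p1 : φ x₁ = x₁ := h.face_fixed he _
  have m0 : ¬ φ.SameCycle c' x₀ := fun h' => hc'0 (h'.eq_of_right p0)
  have q1 : φ₁ x₁ = x₁ := by
    rw [hφ₁, Perm.mul_apply, swap_apply_of_ne_of_ne hc'1.symm h01.symm, p1]
  have m1 : ¬ φ₁.SameCycle d x₁ := fun h' => hd1 (h'.eq_of_right q1)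
  have k0 : φ₁.numOrbits + 1 = φ.numOrbits := numOrbits_mul_swap_of_not_sameCycle m0
  have k1 : φ₂.numOrbits + 1 = φ₁.numOrbits := numOrbits_mul_swap_of_not_sameCycle m1
  have s0 : φ₂.SameCycle c' x₀ :=
    SameCycle.mul_swap m1 ((sameCycle_or_sameCycle_mul_swap φ c' x₀).resolve_left m0)
  have s1 : φ₂.SameCycle d x₁ := (sameCycle_or_sameCycle_mul_swap φ₁ d x₁).resolve_left m1
  have hcard : (insert e S).card = S.card + 1 := Finset.card_insert_of_notMem he
  refine ⟨ρ', hrot, ?_⟩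
  by_cases hs : φ.SameCycle c' d
  · right
    have s : φ₂.SameCycle x₀ x₁ :=
      s0.symm.trans ((SameCycle.mul_swap m1 (SameCycle.mul_swap m0 hs)).trans s1)
    have k2 := numOrbits_mul_swap_of_sameCycle h01 s
    have ns := not_sameCycle_mul_swap h01 s
    refine ⟨hs, by rw [faceCount, faceCount, hface, ← hφ, hcard]; omega, fun z => ?_⟩
    have A0 : Active (insert e S) x₀ := active_inl (Finset.mem_insert_self _ _) _
    have A1 : Active (insert e S) x₁ := active_inl (Finset.mem_insert_self _ _) _
    have fl0 : flip (insert e S) x₀ = x₁ := flip_of_mem (Finset.mem_insert_self _ _) _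
    have fl1 : flip (insert e S) x₁ = x₀ := by
      rw [hx₁, flip_of_mem (Finset.mem_insert_self _ _), Bool.not_not]
    -- `x₀` and `x₁` lie on the two faces that arise from the split; a corner is wanted on the one
    -- that misses `z`.
    by_cases hz : (face (insert e S) ρ').SameCycle x₁ z
    · have hz0 : ¬ (face (insert e S) ρ').SameCycle x₀ z := fun h' =>
        ns (by rw [← hface]; exact h'.trans hz.symm)
      -- The corner behind `x₁` lies on the face of `x₀`, but is at the right vertex only for a
      -- loop. Otherwise `c ≠ d`, so `x₀` still follows `c`, and the corner behind `c` is on the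
      -- face of `x₀`.
      by_cases hl : t (e, !b) = t (e, b)
      · exact ⟨x₁, A1, hl, by rwa [fl1]⟩
      · refine ⟨c, fun f b' h' => Finset.mem_insert_of_mem (hc f b' h'), hct, fun h' => hz0 ?_⟩
        refine SameCycle.trans (SameCycle.symm (sameCycle_of_apply_eq ?_)) h'
        rw [face_apply, flip_flip, hρ', hρ₁, Perm.mul_apply, Perm.mul_apply,
          swap_apply_of_ne_of_ne _ hc1, swap_apply_left, f0]
        rintro rfl
        exact hl hct
    · exact ⟨x₀, A0, rfl, by rwa [fl0]⟩
  · left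
    refine ⟨hs, ?_⟩
    have s : ¬ φ₂.SameCycle x₀ x₁ := by
      intro h'
      have h2 : φ₂.SameCycle c' d := s0.trans (h'.trans s1.symm)
      have h3 : φ₁.SameCycle c' d := h2.collapse_mul_swap
        (fun h' => hc'1 (h'.eq_of_left q1).symm) (fun h' => hd1 (h'.eq_of_left q1).symm)
      exact hs (h3.collapse_mul_swap
        (fun h' => hc'0 (h'.eq_of_left p0).symm) (fun h' => hd0 (h'.eq_of_left p0).symm))
    have k2 := numOrbits_mul_swap_of_not_sameCycle s
    rw [faceCount, faceCount, hface, ← hφ, hcard]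
    omega

/-- An added edge increases the number of faces by one at most. -/
theorem IsRotation.exists_insert_le (h : IsRotation t S ρ) {e : E} (he : e ∉ S) :
    ∃ ρ', IsRotation t (insert e S) ρ' ∧ faceCount (insert e S) ρ' ≤ faceCount S ρ + 1 := by
  obtain ⟨ρ', h', hf⟩ := h.exists_insert he true (active_inr S (t (e, true))) rfl
  exact ⟨ρ', h', by omega⟩

/-- Two edges with a common end can be added without increasing the number of faces. -/
theorem IsRotation.exists_insert_insert (h : IsRotation t S ρ) {e f : E} (he : e ∉ S) (hf : f ∉ S)
    (hef : e ≠ f) {b b' : Bool} (hv : t (e, b) = t (f, b')) :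
    ∃ ρ', IsRotation t (insert f (insert e S)) ρ' ∧
      faceCount (insert f (insert e S)) ρ' ≤ faceCount S ρ := by
  have hf' : f ∉ insert e S := by simp [hef.symm, hf]
  obtain ⟨ρ₁, h₁, ⟨-, hn⟩ | ⟨-, hn, hc⟩⟩ := h.exists_insert he b (active_inr S (t (e, b))) rfl
  · obtain ⟨ρ₂, h₂, hf₂⟩ := h₁.exists_insert_le hf'
    exact ⟨ρ₂, h₂, by omega⟩
  · obtain ⟨c, hca, hct, hcs⟩ := hc (.inr (t (f, !b')))
    obtain ⟨ρ₂, h₂, ⟨-, hm⟩ | ⟨hs, -⟩⟩ := h₁.exists_insert hf' b' hca (hct.trans hv)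
    · exact ⟨ρ₂, h₂, by omega⟩
    · exact absurd hs hcs

theorem IsRotation.erase [DecidableEq V] (h : IsRotation t S ρ) {e : E} (he : e ∈ S)
    (b : Bool) : IsRotation t (S.erase e) (eraseEdge ρ e b) := by
  have hv : ∀ (π : Perm (MarkedDart E V)), (∀ x, vert t (π x) = vert t x) →
      ∀ y x, vert t (π.erasePoint y x) = vert t x := by
    intro π hπ y x
    rw [erasePoint_eq, Perm.mul_apply, vert_swap (hπ y).symm, hπ]
  have hself : ∀ b', eraseEdge ρ e b (.inl (e, b')) = .inl (e, b') := by
    intro b'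
    by_cases hb : b' = b
    · subst hb
      have : ρ.erasePoint (.inl (e, b')) (.inl (e, b')) = .inl (e, b') := erasePoint_self _ _
      rw [eraseEdge, erasePoint_apply_of_ne _ (by simp) (by simp [this]), this]
    · replace hb : b' = !b := Bool.eq_not.2 hb
      subst hb
      exact erasePoint_self _ _
  refine ⟨fun f hf b' => ?_, fun x => hv _ (hv _ h.vert_apply _) _ _, fun f hf b' => ?_⟩
  · by_cases hfe : f = e
    · subst hfe; exact hself b'
    · have hfS : f ∉ S := fun h' => hf (Finset.mem_erase.2 ⟨hfe, h'⟩)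
      have hfix := h.fixed f hfS b'
      rw [eraseEdge_apply_of_ne] <;> simp [hfix, hfe]
  · have hfe := Finset.ne_of_mem_erase hf
    exact ((h.sameCycle f (Finset.mem_of_mem_erase hf) b').erasePoint (by simp [hfe])
      (by simp)).erasePoint (by simp [hfe]) (by simp)

/-- This reverses an insertion: three transpositions rebuild the old face permutation from the new
one. The first two always merge and are offset by the term `2 * S.card`; the third merges or splits
according to the faces at `e`. -/
theorem IsRotation.faceCount_eraseEdge [DecidableEq V] (h : IsRotation t S ρ) {e : E} (he : e ∈ S)
    (b : Bool) :
    ((face S ρ).SameCycle (.inl (e, b)) (.inl (e, !b)) ∧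
        faceCount (S.erase e) (eraseEdge ρ e b) = faceCount S ρ + 1) ∨
      (¬ (face S ρ).SameCycle (.inl (e, b)) (.inl (e, !b)) ∧
        faceCount (S.erase e) (eraseEdge ρ e b) + 1 = faceCount S ρ) := by
  have h' := h.erase he b
  set ρ' := eraseEdge ρ e b with hρ'
  set x₀ : MarkedDart E V := .inl (e, b) with hx₀
  set x₁ : MarkedDart E V := .inl (e, !b) with hx₁
  set c := ρ⁻¹ x₀ with hc
  set ρ₁ := ρ.erasePoint x₀ with hρ₁
  set d := ρ₁⁻¹ x₁ with hd
  have h01 : x₀ ≠ x₁ := by simp [hx₀, hx₁]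
  have hρc : ρ c = x₀ := by rw [hc, ← Perm.mul_apply, mul_inv_cancel, Perm.one_apply]
  have hρd : ρ₁ d = x₁ := by rw [hd, ← Perm.mul_apply, mul_inv_cancel, Perm.one_apply]
  have hc0 : c ≠ x₀ := fun h1 => h.apply_ne he b (by rwa [h1] at hρc)
  have hρ₁0 : ρ₁ x₀ = x₀ := erasePoint_self _ _
  have hd0 : d ≠ x₀ := fun h1 => h01 (by rw [← hρd, h1, hρ₁0])
  have hd1 : d ≠ x₁ := by
    intro h1
    have h2 : ρ₁ x₁ = x₁ := by rw [← h1, hρd, h1]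
    have h3 : ρ₁.SameCycle x₁ (.inr (t (e, !b))) :=
      (h.sameCycle e he (!b)).erasePoint h01.symm (by simp [hx₀])
    have h4 := h3.eq_of_left h2
    simp [hx₁] at h4
  have hE1 : ρ = ρ₁ * swap c x₀ := by
    rw [hρ₁, erasePoint, mul_assoc, swap_mul_self, mul_one]
  have hE2 : ρ₁ = ρ' * swap d x₁ := by
    rw [hρ', eraseEdge, erasePoint, mul_assoc, swap_mul_self, mul_one]
  have F0 : flip S x₀ = x₁ := flip_of_mem he b
  have F1 : flip S x₁ = x₀ := by rw [← F0, flip_flip]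
  set φ' := face (S.erase e) ρ' with hφ'
  set c' := flip S c with hc'
  set d' := flip S d with hd'
  have hc'1 : c' ≠ x₁ := fun h1 => hc0 (by rw [← flip_flip S c, ← hc', h1, F1])
  have hd'1 : d' ≠ x₁ := fun h1 => hd0 (by rw [← flip_flip S d, ← hd', h1, F1])
  have hd'0 : d' ≠ x₀ := fun h1 => hd1 (by rw [← flip_flip S d, ← hd', h1, F0])
  set φ₁ := φ' * swap x₀ x₁ with hφ₁
  set φ₂ := φ₁ * swap d' x₀ with hφ₂
  have hface : face S ρ = φ₂ * swap c' x₁ := by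
    have e1 : swap d x₁ * flip S = flip S * swap d' x₀ := by
      rw [Equiv.mul_swap_eq_swap_mul, F0, hd', flip_flip]
    have e0 : swap c x₀ * flip S = flip S * swap c' x₁ := by
      rw [Equiv.mul_swap_eq_swap_mul, F1, hc', flip_flip]
    have e2 : φ₁ = ρ' * flip S := by
      rw [hφ₁, hφ', face, mul_assoc, ← flip_erase he b]
    rw [face, hE1, hE2, hφ₂, e2, mul_assoc, e0, ← mul_assoc, mul_assoc ρ', e1]
    simp only [mul_assoc]
  have hφc : face S ρ c' = x₀ := by rw [face_apply, hc', flip_flip, hρc]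
  have p0 : φ' x₀ = x₀ := h'.face_fixed (Finset.notMem_erase e S) b
  have p1 : φ' x₁ = x₁ := h'.face_fixed (Finset.notMem_erase e S) _
  have m0 : ¬ φ'.SameCycle x₀ x₁ := fun h1 => h01 (h1.eq_of_left p0)
  have m1 : ¬ φ₁.SameCycle d' x₀ := by
    intro h1
    have hZ : ∀ x ∈ ({x₀, x₁} : Set (MarkedDart E V)), φ₁ x ∈ ({x₀, x₁} : Set _) := by
      rintro x (rfl | rfl) <;> simp [hφ₁, p0, p1]
    rcases h1.symm.mem_of_mapsTo hZ (by simp) with h2 | h2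
    · exact hd'0 h2
    · exact hd'1 h2
  have k0 : φ₁.numOrbits + 1 = φ'.numOrbits := numOrbits_mul_swap_of_not_sameCycle m0
  have k1 : φ₂.numOrbits + 1 = φ₁.numOrbits := numOrbits_mul_swap_of_not_sameCycle m1
  have hcard : (S.erase e).card + 1 = S.card := Finset.card_erase_add_one he
  have hiff : φ₂.SameCycle c' x₁ ↔ ¬ (face S ρ).SameCycle x₀ x₁ := by
    have h1 := sameCycle_mul_swap_iff (π := φ₂) hc'1
    rw [← hface] at h1
    have h2 : (face S ρ).SameCycle c' x₀ := sameCycle_of_apply_eq hφc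
    have h3 : (face S ρ).SameCycle c' x₁ ↔ (face S ρ).SameCycle x₀ x₁ :=
      ⟨h2.symm.trans, h2.trans⟩
    rw [h3] at h1
    tauto
  by_cases hs : (face S ρ).SameCycle x₀ x₁
  · have k2 : (face S ρ).numOrbits + 1 = φ₂.numOrbits := by
      rw [hface]
      exact numOrbits_mul_swap_of_not_sameCycle fun h1 => (hiff.1 h1) hs
    exact .inl ⟨hs, by rw [faceCount, faceCount, ← hφ']; omega⟩
  · have k2 : (face S ρ).numOrbits = φ₂.numOrbits + 1 := by
      rw [hface]
      exact numOrbits_mul_swap_of_sameCycle hc'1 (hiff.2 hs)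
    exact .inr ⟨hs, by rw [faceCount, faceCount, ← hφ']; omega⟩

/-- If the face walk that starts with `(e, b)` passes `(f, b')` but not `(f, !b')` before it
gets to `(e, !b)`, then the two half-edges of `f` are on different faces after the deletion
of `e`. -/
theorem not_sameCycle_face_eraseEdge [DecidableEq V] {e f : E}
    (he : e ∈ S) {b b' : Bool} {j k : ℕ} (hj : 0 < j) (hjk : j < k)
    (hk : ((face S ρ) ^ k) (.inl (e, b)) = .inl (e, !b))
    (hmin : ∀ i, 0 < i → i < k → ((face S ρ) ^ i) (.inl (e, b)) ≠ .inl (e, !b))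
    (hf : ((face S ρ) ^ j) (.inl (e, b)) = .inl (f, b'))
    (hf' : ∀ i, 0 < i → i < k → ((face S ρ) ^ i) (.inl (e, b)) ≠ .inl (f, !b')) :
    ¬ (face (S.erase e) (eraseEdge ρ e b)).SameCycle (.inl (f, b')) (.inl (f, !b')) := by
  set φ := face S ρ with hφ
  set x₀ : MarkedDart E V := .inl (e, b) with hx₀
  set x₁ : MarkedDart E V := .inl (e, !b) with hx₁
  have h01 : x₀ ≠ x₁ := by simp [hx₀, hx₁]
  have hmin₀ : ∀ i, 0 < i → i ≤ k → (φ ^ i) x₀ ≠ x₀ := by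
    intro i hi hik h1
    rcases hik.eq_or_lt with rfl | hik
    · exact h01 (h1.symm.trans hk)
    · refine hmin (k - i) (by omega) (by omega) ?_
      rw [← hk]
      conv_lhs => rw [← h1]
      rw [← Perm.mul_apply, ← pow_add, Nat.sub_add_cancel hik.le]
  have F0 : flip S x₀ = x₁ := flip_of_mem he b
  have F1 : flip S x₁ = x₀ := by rw [← F0, flip_flip]
  have hρ1 : ρ x₁ = φ x₀ := by rw [hφ, face_apply, F0]
  -- The interior of the arc from `x₀` to `x₁` closes up after the deletion: the step that led to
  -- `x₁` now skips it and lands on `ρ x₁ = φ x₀`, the first element of the arc.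
  let Z : Set (MarkedDart E V) := {x | ∃ i, 0 < i ∧ i < k ∧ (φ ^ i) x₀ = x}
  have hZ : ∀ x ∈ Z, face (S.erase e) (eraseEdge ρ e b) x ∈ Z := by
    rintro x ⟨i, hi, hik, rfl⟩
    set x := (φ ^ i) x₀ with hx
    have hx0 : x ≠ x₀ := hmin₀ i hi hik.le
    have hx1 : x ≠ x₁ := hmin i hi hik
    have hφx : φ x = (φ ^ (i + 1)) x₀ := by rw [pow_succ', Perm.mul_apply]
    have hfl : flip (S.erase e) x = flip S x := by
      rw [flip_erase he b, Perm.mul_apply, swap_apply_of_ne_of_ne hx0 hx1]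
    have hy0 : flip S x ≠ x₀ := fun h1 => hx1 (by rw [← flip_flip S x, h1, F0])
    have hy1 : flip S x ≠ x₁ := fun h1 => hx0 (by rw [← flip_flip S x, h1, F1])
    have hρy : ρ (flip S x) = φ x := rfl
    rw [face_apply, hfl]
    by_cases hlast : i + 1 = k
    · have h1 : ρ (flip S x) = x₁ := by rw [hρy, hφx, hlast, hk]
      have h2 : (φ ^ 1) x₀ ≠ x₀ := hmin₀ 1 one_pos (by omega)
      rw [eraseEdge_apply_of_eq ρ hy0 h1 (by rw [← hx₁, hρ1]; simpa using h2)]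
      exact ⟨1, one_pos, by omega, by rw [pow_one, ← hρ1]⟩
    · have h0 : ρ (flip S x) ≠ x₀ := by rw [hρy, hφx]; exact hmin₀ _ (by omega) (by omega)
      have h1 : ρ (flip S x) ≠ x₁ := by rw [hρy, hφx]; exact hmin _ (by omega) (by omega)
      rw [eraseEdge_apply_of_ne ρ hy0 hy1 h0 h1]
      exact ⟨i + 1, by omega, by omega, hφx.symm⟩
  intro h1
  obtain ⟨i, hi, hik, hi'⟩ := h1.mem_of_mapsTo hZ ⟨j, hj, hjk, hf⟩
  exact hf' i hi hik hi'

end MarkedDart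

/-! ### The induction that adds the crossing edges. -/

namespace MarkedDart

variable {E V : Type*} {t : E × Bool → V} {S : Finset E} {ρ : Perm (MarkedDart E V)}

theorem IsRotation.apply_marker_of_isolated (h : IsRotation t S ρ) {v : V}
    (hv : ∀ f ∈ S, ∀ b, t (f, b) ≠ v) : ρ (.inr v) = .inr v := by
  have hvert := h.vert_apply (.inr v)
  rcases hx : ρ (.inr v) with ⟨f, b⟩ | w
  · rw [hx] at hvert
    by_cases hf : f ∈ S
    · exact absurd hvert (hv f hf b)
    · have := ρ.injective (hx.trans (h.fixed f hf b).symm)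
      cases this
  · rw [hx] at hvert
    exact congrArg _ hvert

variable [DecidableEq E] [Finite E] [Finite V]

/-- An edge that joins an isolated vertex to another vertex decreases the number of faces by one
(the isolated vertex had a face of its own). -/
theorem IsRotation.exists_insert_pendant (h : IsRotation t S ρ) {e : E} (he : e ∉ S) {b : Bool}
    (hv : ∀ f ∈ S, ∀ b', t (f, b') ≠ t (e, b)) (hl : t (e, !b) ≠ t (e, b)) :
    ∃ ρ', IsRotation t (insert e S) ρ' ∧ faceCount (insert e S) ρ' + 1 = faceCount S ρ := by
  obtain ⟨ρ', h', ⟨-, hf⟩ | ⟨hs, -⟩⟩ := h.exists_insert he b (active_inr S (t (e, b))) rfl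
  · exact ⟨ρ', h', hf⟩
  · have hfix : face S ρ (.inr (t (e, b))) = .inr (t (e, b)) := by
      rw [face_apply, flip_inr, h.apply_marker_of_isolated hv]
    exact absurd (Sum.inr_injective (hs.eq_of_left hfix)).symm hl

/-- If every edge inside `W` has the same face on both sides, then two adjacent edges can be
deleted without a change of the number of faces, or there is a vertex of degree one. -/
theorem IsRotation.exists_erase_erase_or_leaf (h : IsRotation t S ρ) {W : Set V}
    (hS : ∀ e ∈ S, ∀ b, t (e, b) ∈ W → t (e, !b) ∈ W) (hW : ∃ e ∈ S, ∃ b, t (e, b) ∈ W)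
    (hface : ∀ e ∈ S, ∀ b, t (e, b) ∈ W → (face S ρ).SameCycle (.inl (e, b)) (.inl (e, !b))) :
    (∃ e ∈ S, ∃ f ∈ S, e ≠ f ∧ (∃ b b', t (e, b) = t (f, b')) ∧
      ∃ ρ', IsRotation t ((S.erase e).erase f) ρ' ∧
        faceCount ((S.erase e).erase f) ρ' = faceCount S ρ) ∨
      ∃ e ∈ S, ∃ b, t (e, b) ∈ W ∧ ∀ f ∈ S, ∀ b', t (f, b') = t (e, b) → f = e ∧ b' = b := by
  classical
  set φ := face S ρ with hφ
  have hex : ∃ k : ℕ, 0 < k ∧ ∃ e ∈ S, ∃ b, t (e, b) ∈ W ∧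
      (φ ^ k) (.inl (e, b)) = .inl (e, !b) := by
    obtain ⟨e, he, b, hb⟩ := hW
    obtain ⟨k, hk, -, hk'⟩ := (hface e he b hb).exists_pow_eq''
    exact ⟨k, hk, e, he, b, hb, hk'⟩
  -- Since `k` is minimal over all edges inside `W` and both their sides, no such edge has both
  -- half-edges strictly inside the arc.
  obtain ⟨k, ⟨hk0, e, he, b, hb, hk⟩, hkmin⟩ :
      ∃ k : ℕ, (0 < k ∧ ∃ e ∈ S, ∃ b, t (e, b) ∈ W ∧ (φ ^ k) (.inl (e, b)) = .inl (e, !b)) ∧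
        ∀ i < k, 0 < i → ∀ e ∈ S, ∀ b, t (e, b) ∈ W → (φ ^ i) (.inl (e, b)) ≠ .inl (e, !b) :=
    ⟨Nat.find hex, Nat.find_spec hex, fun i hi h0 e he b hb h' =>
      Nat.find_min hex hi ⟨h0, e, he, b, hb, h'⟩⟩
  have hb' := hS e he b hb
  set x₀ : MarkedDart E V := .inl (e, b) with hx₀
  set x₁ : MarkedDart E V := .inl (e, !b) with hx₁
  have hstep : ∀ i j, i ≤ j → (φ ^ (j - i)) ((φ ^ i) x₀) = (φ ^ j) x₀ := by
    intro i j hij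
    rw [← Perm.mul_apply, ← pow_add, Nat.sub_add_cancel hij]
  have hpair : ∀ j, 0 < j → j < k → ∀ f b', (φ ^ j) x₀ = .inl (f, b') → t (f, b') = t (e, !b) →
      (∃ e ∈ S, ∃ f ∈ S, e ≠ f ∧ (∃ b b', t (e, b) = t (f, b')) ∧
      ∃ ρ', IsRotation t ((S.erase e).erase f) ρ' ∧
        faceCount ((S.erase e).erase f) ρ' = faceCount S ρ) := by
    intro j hj hjk f b' hjf hv
    have hfe : e ≠ f := by
      rintro rfl
      by_cases hbb : b' = b
      · subst hbb
        refine hkmin (k - j) (by omega) (by omega) e he b' hb ?_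
        rw [← hx₀] at hjf
        have h1 := hstep j k hjk.le
        rwa [hjf, hk] at h1
      · replace hbb : b' = !b := Bool.eq_not.2 hbb
        subst hbb
        exact hkmin j hjk hj e he b hb hjf
    have hfS : f ∈ S := by
      by_contra hfS
      have h1 : φ.SameCycle x₀ (.inl (f, b')) := ⟨j, by rw [zpow_natCast]; exact hjf⟩
      have h2 := h1.eq_of_right (h.face_fixed hfS b')
      rw [hx₀] at h2
      simp only [Sum.inl.injEq, Prod.mk.injEq] at h2
      exact hfe h2.1
    have hfW : t (f, b') ∈ W := hv ▸ hb'
    refine ⟨e, he, f, hfS, hfe, ⟨!b, b', hv.symm⟩, eraseEdge (eraseEdge ρ e b) f b', ?_, ?_⟩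
    · exact (h.erase he b).erase (Finset.mem_erase.2 ⟨hfe.symm, hfS⟩) b'
    · have hns := not_sameCycle_face_eraseEdge he hj hjk hk
        (fun i hi hik => hkmin i hik hi e he b hb) hjf (fun i hi hik hi' => ?_)
      · have h1 := h.faceCount_eraseEdge he b
        have h2 := (h.erase he b).faceCount_eraseEdge (Finset.mem_erase.2 ⟨hfe.symm, hfS⟩) b'
        have h3 := hface e he b hb
        rcases h1 with ⟨-, h1⟩ | ⟨h1, -⟩
        · rcases h2 with ⟨h2, -⟩ | ⟨-, h2⟩
          · exact absurd h2 hns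
          · omega
        · exact absurd h3 h1
      · rcases lt_trichotomy i j with hij | rfl | hij
        · have h1 := hstep i j hij.le
          rw [hi', hjf] at h1
          refine hkmin (j - i) (by omega) (by omega) f hfS (!b') (hS f hfS b' hfW) ?_
          rw [h1, Bool.not_not]
        · have h1 := hjf.symm.trans hi'
          simp at h1
        · have h1 := hstep j i hij.le
          rw [hi', hjf] at h1
          exact hkmin (i - j) (by omega) (by omega) f hfS b' hfW h1
  have hφ0 : φ x₀ = ρ x₁ := by rw [hφ, face_apply, hx₀, flip_of_mem he]
  have hvert : vert t (ρ x₁) = t (e, !b) := h.vert_apply x₁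
  have hk1 : k ≠ 1 := by
    rintro rfl
    rw [pow_one, hφ0] at hk
    exact h.apply_ne he _ hk
  rcases hx : ρ x₁ with ⟨f, b'⟩ | v
  · rw [hx] at hvert
    exact .inl (hpair 1 one_pos (by omega) f b' (by rw [pow_one, hφ0, hx]) hvert)
  -- Here the marker comes next, so the candidate for `f` is one step further on. If that step
  -- already reaches `x₁`, the cycle consists of `x₁` and the marker, and the vertex is a leaf.
  · rw [hx] at hvert
    have hv : v = t (e, !b) := hvert
    have hφ2 : (φ ^ 2) x₀ = ρ (.inr v) := by
      rw [pow_two, Perm.mul_apply, hφ0, hx, hφ, face_apply, flip_inr]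
    have hvert2 : vert t (ρ (.inr v)) = v := h.vert_apply _
    by_cases hk2 : k = 2
    · subst hk2
      rw [hφ2] at hk
      refine .inr ⟨e, he, !b, hb', fun f hf b' hfb => ?_⟩
      have hZ : ∀ x ∈ ({x₁, .inr v} : Set (MarkedDart E V)), ρ x ∈ ({x₁, .inr v} : Set _) := by
        rintro x (rfl | rfl)
        · exact .inr hx
        · exact .inl hk
      have h1 := (h.sameCycle f hf b').symm.mem_of_mapsTo hZ (.inr (by rw [hfb, hv]; rfl))
      rcases h1 with h1 | h1
      · simpa [hx₁] using h1
      · cases h1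
    · rcases hy : ρ (.inr v) with ⟨f, b'⟩ | w
      · rw [hy] at hvert2
        exact .inl (hpair 2 two_pos (by omega) f b' (by rw [hφ2, hy]) (hvert2.trans hv))
      · rw [hy] at hvert2
        have hw : w = v := hvert2
        subst hw
        have h1 := (h.sameCycle e he (!b)).eq_of_right (hv ▸ hy)
        cases h1

set_option maxHeartbeats 1000000 in
/-- Edges that join a vertex set `W` to its complement, where no edge of a graph joins `W` to its
complement, can be added to a rotation system of this graph without increasing the number of
faces. -/
theorem exists_isRotation_union (n : ℕ) : ∀ (W : Finset V) (S A : Finset E)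
    (ρ : Perm (MarkedDart E V)), W.card + S.card + A.card = n → IsRotation t S ρ →
    Disjoint S A → (∀ e ∈ S, ∀ b, t (e, b) ∈ W → t (e, !b) ∈ W) →
    (∀ e ∈ A, ∀ b, t (e, b) ∈ W ↔ t (e, !b) ∉ W) →
    ∃ ρ', IsRotation t (S ∪ A) ρ' ∧ faceCount (S ∪ A) ρ' ≤ faceCount S ρ := by
  classical
  induction n using Nat.strong_induction_on with
  | _ n ih =>
  intro W S A ρ hn h hd hS hA
  subst hn
  have hdis : ∀ e ∈ S, e ∉ A := fun e he => Finset.disjoint_left.1 hd he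
  -- Deleting an edge with two distinct faces lowers the count by one, which pays for its
  -- reinsertion at the end.
  by_cases hdiff : ∃ e ∈ S, ∃ b, ¬ (face S ρ).SameCycle (.inl (e, b)) (.inl (e, !b))
  · obtain ⟨e, he, b, hs⟩ := hdiff
    have hf := h.faceCount_eraseEdge he b
    have hc := Finset.card_erase_add_one he
    obtain ⟨ρ₁, h₁, hf₁⟩ := ih _ (by omega) W (S.erase e) A _ rfl (h.erase he b)
      (hd.mono_left (Finset.erase_subset _ _))
      (fun f hf => hS f (Finset.mem_of_mem_erase hf)) hA
    obtain ⟨ρ₂, h₂, hf₂⟩ := h₁.exists_insert_le (e := e) (by simp [hdis e he])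
    have hset : insert e (S.erase e ∪ A) = S ∪ A := by
      rw [← Finset.insert_union, Finset.insert_erase he]
    rw [hset] at h₂ hf₂
    refine ⟨ρ₂, h₂, ?_⟩
    rcases hf with ⟨hf, -⟩ | ⟨-, hf⟩
    · exact absurd hf hs
    · omega
  push Not at hdiff
  -- A vertex of `W` with at most one half-edge from `S` can be disposed of, whatever edges of `A`
  -- it meets.
  have hvertex : ∀ v ∈ W, ((∀ f ∈ S, ∀ b, t (f, b) ≠ v) ∨ ∃ e ∈ S, ∃ b, t (e, b) = v ∧
      ∀ f ∈ S, ∀ b', t (f, b') = v → f = e ∧ b' = b) →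
      ∃ ρ', IsRotation t (S ∪ A) ρ' ∧ faceCount (S ∪ A) ρ' ≤ faceCount S ρ := by
    intro v hvW hv
    have hWc := Finset.card_erase_add_one hvW
    by_cases htwo : ∃ f ∈ A, ∃ g ∈ A, f ≠ g ∧ ∃ b b', t (f, b) = v ∧ t (g, b') = v
    · obtain ⟨f, hf, g, hg, hfg, b, b', hfb, hgb⟩ := htwo
      have hg' : g ∈ A.erase f := Finset.mem_erase.2 ⟨hfg.symm, hg⟩
      have hc := Finset.card_erase_add_one hf
      have hc' := Finset.card_erase_add_one hg'
      obtain ⟨ρ₁, h₁, hf₁⟩ := ih _ (by omega) W S ((A.erase f).erase g) ρ rfl h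
        (hd.mono_right ((Finset.erase_subset _ _).trans (Finset.erase_subset _ _))) hS
        (fun e he => hA e (Finset.mem_of_mem_erase (Finset.mem_of_mem_erase he)))
      obtain ⟨ρ₂, h₂, hf₂⟩ := h₁.exists_insert_insert (e := f) (f := g) (b := b) (b' := b')
        (by simp only [Finset.mem_union, Finset.mem_erase]; grind)
        (by simp only [Finset.mem_union, Finset.mem_erase]; grind) hfg (hfb.trans hgb.symm)
      have hset : insert g (insert f (S ∪ (A.erase f).erase g)) = S ∪ A := by
        ext x; simp only [Finset.mem_union, Finset.mem_erase, Finset.mem_insert]; grind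
      rw [hset] at h₂ hf₂
      exact ⟨ρ₂, h₂, hf₂.trans hf₁⟩
    by_cases hone : ∃ g ∈ A, ∃ b, t (g, b) = v
    · obtain ⟨g, hg, b, hgb⟩ := hone
      have huniq : ∀ f ∈ A, ∀ b', t (f, b') = v → f = g := by
        intro f hf b' hfb
        by_contra hne
        exact htwo ⟨f, hf, g, hg, hne, b', b, hfb, hgb⟩
      have hgW : t (g, !b) ∉ W := (hA g hg b).1 (hgb ▸ hvW)
      have hgv : t (g, !b) ≠ t (g, b) := fun h' => hgW (by rw [h', hgb]; exact hvW)
      have hgS : g ∉ S := fun h' => hdis g h' hg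
      have hgW' : ∀ b', t (g, b') ∉ W.erase v := by
        intro b' h'
        by_cases hb : b' = b
        · subst hb; simp [hgb] at h'
        · replace hb : b' = !b := Bool.eq_not.2 hb
          subst hb
          exact hgW (Finset.mem_of_mem_erase h')
      have hAc := Finset.card_erase_add_one hg
      have hAe : ∀ e ∈ A, e ≠ g → ∀ b, t (e, b) ∈ W.erase v ↔ t (e, !b) ∉ W.erase v := by
        intro e he heg b'
        have h0 : ∀ b', t (e, b') ≠ v := fun b' h' => heg (huniq e he b' h')
        simp only [Finset.mem_erase, ne_eq, h0, not_false_eq_true, true_and]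
        exact hA e he b'
      -- With `g` the only edge of `A` at `v`, the vertex changes sides: `g` moves into `S` as a
      -- pendant edge, and a leaf edge `e` of `S` becomes a crossing edge. The pendant insertion
      -- gains one face, which pays for the deletion of `e`.
      rcases hv with hv | ⟨e, he, b', heb, hev⟩
      · obtain ⟨ρ₁, h₁, hf₁⟩ := h.exists_insert_pendant hgS (b := b) (by rwa [hgb]) hgv
        have hSc := Finset.card_insert_of_notMem hgS
        obtain ⟨ρ₂, h₂, hf₂⟩ := ih _ (by omega) (W.erase v) (insert g S) (A.erase g) ρ₁ rfl h₁
          (by rw [Finset.disjoint_left]; grind)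
          (fun f hf b' hfb => by
            rcases Finset.mem_insert.1 hf with rfl | hf
            · exact absurd hfb (hgW' b')
            · exact Finset.mem_erase.2
                ⟨hv f hf _, hS f hf b' (Finset.mem_of_mem_erase hfb)⟩)
          (fun f hf => hAe f (Finset.mem_of_mem_erase hf) (Finset.ne_of_mem_erase hf))
        have hset : insert g S ∪ A.erase g = S ∪ A := by
          ext x; simp only [Finset.mem_union, Finset.mem_erase, Finset.mem_insert]; grind
        rw [hset] at h₂ hf₂
        exact ⟨ρ₂, h₂, by omega⟩
      · have hne : t (e, !b') ≠ v := fun h' => by simpa using (hev e he _ h').2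
        have hgSe : g ∉ S.erase e := fun h' => hgS (Finset.mem_of_mem_erase h')
        have hge : e ≠ g := by rintro rfl; exact hgS he
        have hv' : ∀ f ∈ S.erase e, ∀ b, t (f, b) ≠ v := fun f hf b hfb =>
          (Finset.ne_of_mem_erase hf) (hev f (Finset.mem_of_mem_erase hf) b hfb).1
        obtain ⟨ρ₁, h₁, hf₁⟩ := (h.erase he b').exists_insert_pendant hgSe (b := b)
          (by rwa [hgb]) hgv
        have hf := h.faceCount_eraseEdge he b'
        have hSc := Finset.card_insert_of_notMem hgSe
        have hSc' := Finset.card_erase_add_one he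
        have heA : e ∉ A.erase g := fun h' => hdis e he (Finset.mem_of_mem_erase h')
        have hAc' := Finset.card_insert_of_notMem heA
        obtain ⟨ρ₂, h₂, hf₂⟩ := ih _ (by omega) (W.erase v) (insert g (S.erase e))
          (insert e (A.erase g)) ρ₁ rfl h₁
          (by rw [Finset.disjoint_left]; grind)
          (fun f hf b' hfb => by
            rcases Finset.mem_insert.1 hf with rfl | hf
            · exact absurd hfb (hgW' b')
            · exact Finset.mem_erase.2 ⟨hv' f hf _,
                hS f (Finset.mem_of_mem_erase hf) b' (Finset.mem_of_mem_erase hfb)⟩)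
          (fun f hf b => by
            rcases Finset.mem_insert.1 hf with rfl | hf
            · have h0 : t (f, b') ∉ W.erase v := by simp [heb]
              have h1 : t (f, !b') ∈ W.erase v :=
                Finset.mem_erase.2 ⟨hne, hS f he b' (heb ▸ hvW)⟩
              by_cases hb : b = b'
              · subst hb; tauto
              · replace hb : b = !b' := Bool.eq_not.2 hb
                subst hb
                rw [Bool.not_not]; tauto
            · exact hAe f (Finset.mem_of_mem_erase hf) (Finset.ne_of_mem_erase hf) b)
        have hset : insert g (S.erase e) ∪ insert e (A.erase g) = S ∪ A := by
          ext x; simp only [Finset.mem_union, Finset.mem_erase, Finset.mem_insert]; grind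
        rw [hset] at h₂ hf₂
        exact ⟨ρ₂, h₂, by omega⟩
    · push Not at hone
      have hA' : ∀ e ∈ A, ∀ b, t (e, b) ∈ W.erase v ↔ t (e, !b) ∉ W.erase v := by
        intro e he b
        simp only [Finset.mem_erase, ne_eq, hone e he, not_false_eq_true, true_and]
        exact hA e he b
      rcases hv with hv | ⟨e, he, b, heb, hev⟩
      · exact ih _ (by omega) (W.erase v) S A ρ rfl h hd (fun f hf b hfb =>
          Finset.mem_erase.2 ⟨hv f hf _, hS f hf b (Finset.mem_of_mem_erase hfb)⟩) hA'
      · have hne : t (e, !b) ≠ v := fun h' => by simpa using (hev e he _ h').2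
        have hv' : ∀ f ∈ S.erase e, ∀ b, t (f, b) ≠ v := fun f hf b hfb =>
          (Finset.ne_of_mem_erase hf) (hev f (Finset.mem_of_mem_erase hf) b hfb).1
        -- Deleting the leaf edge costs at most one face, and its reinsertion as a pendant edge
        -- after the induction regains it.
        have hf := h.faceCount_eraseEdge he b
        have hSc' := Finset.card_erase_add_one he
        obtain ⟨ρ₁, h₁, hf₁⟩ := ih _ (by omega) (W.erase v) (S.erase e) A _ rfl (h.erase he b)
          (hd.mono_left (Finset.erase_subset _ _))
          (fun f hf b hfb => Finset.mem_erase.2 ⟨hv' f hf _,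
            hS f (Finset.mem_of_mem_erase hf) b (Finset.mem_of_mem_erase hfb)⟩) hA'
        obtain ⟨ρ₂, h₂, hf₂⟩ := h₁.exists_insert_pendant (e := e) (b := b)
          (by simp [hdis e he])
          (fun f hf b' => by
            rw [heb]
            rcases Finset.mem_union.1 hf with hf | hf
            · exact hv' f hf b'
            · exact hone f hf b') (by rwa [heb])
        have hset : insert e (S.erase e ∪ A) = S ∪ A := by
          rw [← Finset.insert_union, Finset.insert_erase he]
        rw [hset] at h₂ hf₂
        exact ⟨ρ₂, h₂, by omega⟩
  by_cases hedge : ∃ e ∈ S, ∃ b, t (e, b) ∈ W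
  · rcases h.exists_erase_erase_or_leaf (W := (W : Set V)) hS hedge
      (fun e he b _ => hdiff e he b) with
      ⟨e, he, f, hf, hef, ⟨b, b', hbb⟩, ρ₁, h₁, hf₁⟩ | ⟨e, he, b, heW, hleaf⟩
    · have hf' : f ∈ S.erase e := Finset.mem_erase.2 ⟨hef.symm, hf⟩
      have hc := Finset.card_erase_add_one he
      have hc' := Finset.card_erase_add_one hf'
      have hsub : (S.erase e).erase f ⊆ S :=
        (Finset.erase_subset _ _).trans (Finset.erase_subset _ _)
      obtain ⟨ρ₂, h₂, hf₂⟩ := ih _ (by omega) W _ A ρ₁ rfl h₁ (hd.mono_left hsub)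
        (fun g hg => hS g (hsub hg)) hA
      obtain ⟨ρ₃, h₃, hf₃⟩ := h₂.exists_insert_insert (e := e) (f := f) (b := b) (b' := b')
        (by simp only [Finset.mem_union, Finset.mem_erase]; grind)
        (by simp only [Finset.mem_union, Finset.mem_erase]; grind) hef hbb
      have hset : insert f (insert e ((S.erase e).erase f ∪ A)) = S ∪ A := by
        ext x; simp only [Finset.mem_union, Finset.mem_erase, Finset.mem_insert]; grind
      rw [hset] at h₃ hf₃
      exact ⟨ρ₃, h₃, by omega⟩
    · exact hvertex (t (e, b)) heW (.inr ⟨e, he, b, rfl, hleaf⟩)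
  · push Not at hedge
    rcases W.eq_empty_or_nonempty with rfl | ⟨v, hv⟩
    · have hAe : A = ∅ := by
        rw [Finset.eq_empty_iff_forall_notMem]
        intro e he
        have := (hA e he true).2
        simp at this
      subst hAe
      rw [Finset.union_empty]
      exact ⟨ρ, h, le_rfl⟩
    · exact hvertex v hv (.inl fun f hf b hfb => hedge f hf b (hfb ▸ hv))

end MarkedDart

/-! ### Transport of orbits, and removal of the markers from cycles. -/

namespace Equiv.Perm

variable {X Y B V : Type*}

theorem sameCycle_permCongr {e : X ≃ Y} {π : Perm X} {x y : X} :
    (e.permCongr π).SameCycle (e x) (e y) ↔ π.SameCycle x y := by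
  constructor
  · intro h
    have := h.eq_of_invariant (f := fun y => Quotient.mk (SameCycle.setoid π) (e.symm y))
      fun y => Quotient.sound (SameCycle.symm (sameCycle_of_apply_eq (by simp)))
    rw [Equiv.symm_apply_apply, Equiv.symm_apply_apply] at this
    exact Quotient.exact this
  · intro h
    exact Quotient.exact (h.eq_of_invariant
      (f := fun x => Quotient.mk (SameCycle.setoid (e.permCongr π)) (e x))
      fun x => Quotient.sound (SameCycle.symm (sameCycle_of_apply_eq (by simp))))

theorem numOrbits_permCongr (e : X ≃ Y) (π : Perm X) :
    (e.permCongr π).numOrbits = π.numOrbits :=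
  (Nat.card_congr (Quotient.congr e fun _ _ => sameCycle_permCongr.symm)).symm

theorem sameCycle_sumCongr_inl {π : Perm X} {π' : Perm Y} {x y : X} :
    (sumCongr π π').SameCycle (.inl x) (.inl y) ↔ π.SameCycle x y := by
  constructor
  · intro h
    have := h.eq_of_invariant (f := Sum.elim
      (fun x => some (Quotient.mk (SameCycle.setoid π) x)) (fun _ => none)) (by
        rintro (x | x)
        · exact congrArg some (Quotient.sound (sameCycle_apply π x).symm)
        · rfl)
    exact Quotient.exact (Option.some_injective _ this)
  · intro h
    exact Quotient.exact (h.eq_of_invariant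
      (f := fun x => Quotient.mk (SameCycle.setoid (sumCongr π π')) (.inl x))
      fun x => Quotient.sound (SameCycle.symm (sameCycle_of_apply_eq (by simp))))

theorem sameCycle_sumCongr_inr {π : Perm X} {π' : Perm Y} {x y : Y} :
    (sumCongr π π').SameCycle (.inr x) (.inr y) ↔ π'.SameCycle x y := by
  constructor
  · intro h
    have := h.eq_of_invariant (f := Sum.elim
      (fun _ => none) (fun x => some (Quotient.mk (SameCycle.setoid π') x))) (by
        rintro (x | x)
        · rfl
        · exact congrArg some (Quotient.sound (sameCycle_apply π' x).symm))
    exact Quotient.exact (Option.some_injective _ this)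
  · intro h
    exact Quotient.exact (h.eq_of_invariant
      (f := fun x => Quotient.mk (SameCycle.setoid (sumCongr π π')) (.inr x))
      fun x => Quotient.sound (SameCycle.symm (sameCycle_of_apply_eq (by simp))))

theorem not_sameCycle_sumCongr {π : Perm X} {π' : Perm Y} {x : X} {y : Y} :
    ¬ (sumCongr π π').SameCycle (.inl x) (.inr y) := by
  intro h
  have := h.eq_of_invariant (f := Sum.isLeft) (by rintro (x | x) <;> rfl)
  simp at this

theorem numOrbits_sumCongr [Finite X] [Finite Y] (π : Perm X) (π' : Perm Y) :
    (sumCongr π π').numOrbits = π.numOrbits + π'.numOrbits := by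
  rw [numOrbits, numOrbits, numOrbits, ← Nat.card_sum]
  symm
  refine Nat.card_eq_of_bijective (Sum.elim
    (Quotient.map Sum.inl fun _ _ h => sameCycle_sumCongr_inl.2 h)
    (Quotient.map Sum.inr fun _ _ h => sameCycle_sumCongr_inr.2 h)) ⟨?_, ?_⟩
  · rintro (x | x) (y | y) h <;> induction x using Quotient.inductionOn <;>
      induction y using Quotient.inductionOn
    · exact congrArg _ (Quotient.sound (sameCycle_sumCongr_inl.1 (Quotient.exact h)))
    · exact absurd (Quotient.exact h) not_sameCycle_sumCongr
    · exact absurd (Quotient.exact h).symm not_sameCycle_sumCongr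
    · exact congrArg _ (Quotient.sound (sameCycle_sumCongr_inr.1 (Quotient.exact h)))
  · rintro ⟨x | x⟩
    · exact ⟨.inl (Quotient.mk _ x), rfl⟩
    · exact ⟨.inr (Quotient.mk _ x), rfl⟩

/-- `σ` arises from `π` by leaving out the elements of `V` from the cycles. -/
structure IsContraction (π : Perm (B ⊕ V)) (σ : Perm B) : Prop where
  skip : ∀ b, π (.inl b) = .inl (σ b) ∨ ∃ v, π (.inl b) = .inr v ∧ π (.inr v) = .inl (σ b)
  fixed : ∀ v, π (.inr v) = .inr v ∨ ∃ b, π (.inl b) = .inr v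

namespace IsContraction

variable {π : Perm (B ⊕ V)} {σ : Perm B}

/-- A marker inside a cycle is sent to the orbit of the half-edge before it, a fixed marker to a
class of its own. On orbits this gives the inverse of the map in `numOrbits_eq`. -/
theorem exists_invariant (h : IsContraction π σ) :
    ∃ f : B ⊕ V → Quotient (SameCycle.setoid σ) ⊕ {v // π (.inr v) = .inr v},
      (∀ x, f (π x) = f x) ∧ (∀ b, f (.inl b) = .inl (Quotient.mk _ b)) ∧
        ∀ v, f (.inr v.1) = .inr v := by
  classical
  let f : B ⊕ V → Quotient (SameCycle.setoid σ) ⊕ {v // π (.inr v) = .inr v} := fun x =>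
    match x with
    | .inl b => .inl (Quotient.mk _ b)
    | .inr v => if hv : π (.inr v) = .inr v then .inr ⟨v, hv⟩ else
        .inl (Quotient.mk _ ((h.fixed v).resolve_left hv).choose)
  have hf : ∀ b v, π (.inl b) = .inr v → f (.inr v) = .inl (Quotient.mk _ b) := by
    intro b v hb
    have hv : ¬ π (.inr v) = .inr v := fun hv => by cases π.injective (hb.trans hv.symm)
    have hc := ((h.fixed v).resolve_left hv).choose_spec
    simp only [f, hv, dif_neg, not_false_eq_true]
    rw [Sum.inl_injective (π.injective (hc.trans hb.symm))]
  refine ⟨f, ?_, fun b => rfl, fun v => by simp [f, v.2]⟩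
  rintro (b | v)
  · rcases h.skip b with hb | ⟨v, hv, -⟩
    · rw [hb]
      exact congrArg Sum.inl (Quotient.sound (sameCycle_apply σ b).symm)
    · rw [hv, hf b v hv]
  · rcases h.fixed v with hv | ⟨b, hb⟩
    · rw [hv]
    · rw [hf b v hb]
      rcases h.skip b with hb' | ⟨w, hw, hw'⟩
      · cases hb.symm.trans hb'
      · cases hb.symm.trans hw
        rw [hw']
        exact congrArg Sum.inl (Quotient.sound (sameCycle_apply σ b).symm)

theorem sameCycle_iff (h : IsContraction π σ) {b b' : B} :
    π.SameCycle (.inl b) (.inl b') ↔ σ.SameCycle b b' := by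
  constructor
  · intro h'
    obtain ⟨f, hf, hb, -⟩ := h.exists_invariant
    have := h'.eq_of_invariant hf
    rw [hb, hb] at this
    exact Quotient.exact (Sum.inl_injective this)
  · intro h'
    refine Quotient.exact (h'.eq_of_invariant
      (f := fun b => Quotient.mk (SameCycle.setoid π) (.inl b)) fun b => Quotient.sound ?_)
    rcases h.skip b with hb | ⟨v, hv, hv'⟩
    · exact SameCycle.symm (sameCycle_of_apply_eq hb)
    · exact ((sameCycle_of_apply_eq hv).trans (sameCycle_of_apply_eq hv')).symm

theorem numOrbits_eq [Finite B] [Finite V] (h : IsContraction π σ) :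
    π.numOrbits = σ.numOrbits + Nat.card {v // π (.inr v) = .inr v} := by
  rw [numOrbits, numOrbits, ← Nat.card_sum]
  symm
  obtain ⟨f, hf, hb, hv⟩ := h.exists_invariant
  let g : Quotient (SameCycle.setoid σ) ⊕ {v // π (.inr v) = .inr v} →
      Quotient (SameCycle.setoid π) :=
    Sum.elim (Quotient.map Sum.inl fun _ _ h' => h.sameCycle_iff.2 h')
      (fun v => Quotient.mk _ (.inr v.1))
  let f' : Quotient (SameCycle.setoid π) →
      Quotient (SameCycle.setoid σ) ⊕ {v // π (.inr v) = .inr v} :=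
    Quotient.lift f fun _ _ h' => SameCycle.eq_of_invariant hf h'
  have hfg : Function.LeftInverse f' g := by
    rintro (b | v)
    · induction b using Quotient.inductionOn with
      | _ b => exact hb b
    · exact hv v
  refine Nat.card_eq_of_bijective g ⟨hfg.injective, ?_⟩
  rintro ⟨b | v⟩
  · exact ⟨.inl (Quotient.mk _ b), rfl⟩
  · rcases h.fixed v with hv | ⟨b, hb⟩
    · exact ⟨.inr ⟨v, hv⟩, rfl⟩
    · exact ⟨.inl (Quotient.mk _ b), Quotient.sound (sameCycle_of_apply_eq hb)⟩

end IsContraction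

end Equiv.Perm

namespace MarkedDart

/-- The involution that exchanges the two half-edges of every edge. -/
def rev (E : Type*) : Perm (E × Bool) := (Equiv.refl E).prodCongr Equiv.boolNot

@[simp] theorem rev_apply {E : Type*} (e : E) (b : Bool) : rev E (e, b) = (e, !b) := rfl

variable {E V : Type*} {t : E × Bool → V} {S : Finset E} {ρ : Perm (MarkedDart E V)}

theorem IsRotation.apply_marker_eq_iff (h : IsRotation t S ρ) {v : V} :
    ρ (.inr v) = .inr v ↔ ∀ e ∈ S, ∀ b, t (e, b) ≠ v := by
  refine ⟨fun hv e he b heb => ?_, h.apply_marker_of_isolated⟩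
  subst heb
  cases (h.sameCycle e he b).eq_of_right hv

/-- The markers can be left out of the cycles of a rotation. -/
theorem IsRotation.exists_isContraction [Finite E] (h : IsRotation t S ρ) :
    ∃ σ : Perm (E × Bool), IsContraction ρ σ := by
  have hex : ∀ d : E × Bool, ∃ d', ρ (.inl d) = .inl d' ∨
      ∃ v, ρ (.inl d) = .inr v ∧ ρ (.inr v) = .inl d' := by
    intro d
    rcases hd : ρ (.inl d) with d' | v
    · exact ⟨d', .inl rfl⟩
    · rcases hv : ρ (.inr v) with d' | w
      · exact ⟨d', .inr ⟨v, rfl, hv⟩⟩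
      · have hw := h.vert_apply (.inr v)
        rw [hv] at hw
        have hw : w = v := hw
        subst hw
        cases ρ.injective (hd.trans hv.symm)
  choose s hs using hex
  have hinj : Function.Injective s := by
    intro d d' hdd
    rcases hs d with h1 | ⟨v, h1, h2⟩ <;> rcases hs d' with h3 | ⟨w, h3, h4⟩
    · exact Sum.inl_injective (ρ.injective (h1.trans (hdd ▸ h3.symm)))
    · cases ρ.injective (h1.trans (hdd ▸ h4.symm))
    · cases ρ.injective (h2.trans (hdd ▸ h3.symm))
    · have hvw := Sum.inr_injective (ρ.injective (h2.trans (hdd ▸ h4.symm)))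
      subst hvw
      exact Sum.inl_injective (ρ.injective (h1.trans h3.symm))
  refine ⟨Equiv.ofBijective s (Finite.injective_iff_bijective.1 hinj), hs, fun v => ?_⟩
  obtain ⟨x, hx⟩ := ρ.surjective (.inr v)
  rcases x with d | w
  · exact .inr ⟨d, hx⟩
  · have hw := h.vert_apply (.inr w)
    rw [hx] at hw
    have hw : v = w := hw
    exact .inl (hw ▸ hx)

variable [DecidableEq E]

theorem isContraction_face {σ τ : Perm (E × Bool)} (h : IsContraction ρ σ)
    (hτ : ∀ d, flip S (.inl d) = (.inl (τ d) : MarkedDart E V)) :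
    IsContraction (face S ρ) (σ * τ) := by
  refine ⟨fun d => ?_, fun v => ?_⟩
  · simp only [face_apply, hτ, flip_inr]
    exact h.skip (τ d)
  · rcases h.fixed v with hv | ⟨d, hd⟩
    · exact .inl hv
    · refine .inr ⟨τ⁻¹ d, ?_⟩
      rw [face_apply, hτ, ← Perm.mul_apply, mul_inv_cancel]
      exact hd

/-- Markers can be put into the cycles of a rotation. -/
theorem exists_isRotation {σ : Perm (E × Bool)} (hfix : ∀ e ∉ S, ∀ b, σ (e, b) = (e, b))
    (hσ : ∀ e ∈ S, ∀ b, ∀ e' ∈ S, ∀ b', σ.SameCycle (e, b) (e', b') ↔ t (e, b) = t (e', b')) :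
    ∃ ρ : Perm (MarkedDart E V), IsRotation t S ρ ∧ IsContraction ρ σ := by
  classical
  have ha : ∃ a : V → Option (E × Bool), (∀ v d, a v = some d → d.1 ∈ S ∧ t d = v) ∧
      ∀ v, a v = none → ∀ e ∈ S, ∀ b, t (e, b) ≠ v := by
    refine ⟨fun v => if hv : ∃ d : E × Bool, d.1 ∈ S ∧ t d = v then some hv.choose else none,
      fun v d hd => ?_, fun v hv e he b heb => ?_⟩
    · dsimp only at hd
      split_ifs at hd with h
      cases hd
      exact h.choose_spec
    · dsimp only at hv
      split_ifs at hv with h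
      exact h ⟨(e, b), he, heb⟩
  obtain ⟨a, ha, ha'⟩ := ha
  -- `a` picks a half-edge at each non-isolated vertex. Exchanging it with the marker before
  -- applying `σ` puts the marker directly behind it.
  let γ : Perm (MarkedDart E V) := Function.Involutive.toPerm
    (fun x => match x with
      | .inl d => if a (t d) = some d then .inr (t d) else .inl d
      | .inr v => match a v with
        | some d => .inl d
        | none => .inr v)
    (by
      rintro (d | v)
      · by_cases hd : a (t d) = some d <;> simp [hd]
      · rcases hv : a v with _ | d
        · simp [hv]
        · simp [hv, (ha v d hv).2])
  have hγ₁ : ∀ d, a (t d) = some d → γ (.inl d) = .inr (t d) := fun d hd => if_pos hd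
  have hγ₂ : ∀ d, a (t d) ≠ some d → γ (.inl d) = .inl d := fun d hd => if_neg hd
  have hγ₃ : ∀ v d, a v = some d → γ (.inr v) = .inl d := fun v d hv => by
    change (match a v with | some d => _ | none => _) = _
    rw [hv]
  have hγ₄ : ∀ v, a v = none → γ (.inr v) = .inr v := fun v hv => by
    change (match a v with | some d => _ | none => _) = _
    rw [hv]
  let ρ : Perm (MarkedDart E V) := Perm.sumCongr σ 1 * γ
  have hρ₁ : ∀ d, a (t d) = some d → ρ (.inl d) = .inr (t d) := fun d hd => by
    simp [ρ, hγ₁ d hd]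
  have hρ₂ : ∀ d, a (t d) ≠ some d → ρ (.inl d) = .inl (σ d) := fun d hd => by
    simp [ρ, hγ₂ d hd]
  have hρ₃ : ∀ v d, a v = some d → ρ (.inr v) = .inl (σ d) := fun v d hv => by
    simp [ρ, hγ₃ v d hv]
  have hρ₄ : ∀ v, a v = none → ρ (.inr v) = .inr v := fun v hv => by
    simp [ρ, hγ₄ v hv]
  have hcon : IsContraction ρ σ := by
    refine ⟨fun d => ?_, fun v => ?_⟩
    · by_cases hd : a (t d) = some d
      · exact .inr ⟨t d, hρ₁ d hd, hρ₃ _ _ hd⟩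
      · exact .inl (hρ₂ d hd)
    · rcases hv : a v with _ | d
      · exact .inl (hρ₄ v hv)
      · have htd := (ha v d hv).2
        exact .inr ⟨d, by rw [hρ₁ d (by rw [htd, hv]), htd]⟩
  have htσ : ∀ d, t (σ d) = t d := by
    rintro ⟨e, b⟩
    by_cases he : e ∈ S
    · rcases hσd : σ (e, b) with ⟨e', b'⟩
      by_cases he' : e' ∈ S
      · exact ((hσ e he b e' he' b').1 (sameCycle_of_apply_eq hσd)).symm
      · rw [← hσd, σ.injective (hσd.trans (hfix e' he' b').symm), hfix e' he' b']
    · rw [hfix e he]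
  refine ⟨ρ, ⟨fun e he b => ?_, ?_, fun e he b => ?_⟩, hcon⟩
  · rw [hρ₂ _ fun h => he (ha _ _ h).1, hfix e he]
  · rintro (d | v)
    · by_cases hd : a (t d) = some d
      · rw [hρ₁ d hd]; rfl
      · rw [hρ₂ d hd]; exact htσ d
    · rcases hv : a v with _ | d
      · rw [hρ₄ v hv]
      · rw [hρ₃ v d hv]; exact (htσ d).trans (ha v d hv).2
  · rcases hv : a (t (e, b)) with _ | ⟨e', b'⟩
    · exact absurd rfl (ha' _ hv e he b)
    · obtain ⟨he', htd⟩ := ha _ _ hv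
      refine (hcon.sameCycle_iff.2 ((hσ e he b e' he' b').2 htd.symm)).trans
        (sameCycle_of_apply_eq ?_)
      rw [hρ₁ _ (by rw [htd, hv]), htd]

variable [Finite E] [Finite V]

theorem IsRotation.numOrbits_face (h : IsRotation t S ρ) {σ τ : Perm (E × Bool)}
    (hc : IsContraction ρ σ) (hτ : ∀ d, flip S (.inl d) = (.inl (τ d) : MarkedDart E V)) :
    (face S ρ).numOrbits = (σ * τ).numOrbits + Nat.card {v // ∀ e ∈ S, ∀ b, t (e, b) ≠ v} := by
  rw [(isContraction_face hc hτ).numOrbits_eq]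
  congr 1
  exact Nat.card_congr (Equiv.subtypeEquivRight fun v => h.apply_marker_eq_iff)

end MarkedDart

/-! ### Gluing two rotation systems, and the parity of the number of faces. -/

namespace MarkedDart

section Glue

variable {E₁ E₂ E₃ V₁ V₂ : Type*}

/-- The half-edges of the disjoint union of two graphs with the edges in `E₃` added between
them. -/
def glueTail (t₁ : E₁ × Bool → V₁) (t₂ : E₂ × Bool → V₂) (a₁ : E₃ → V₁) (a₂ : E₃ → V₂) :
    ((E₁ ⊕ E₂) ⊕ E₃) × Bool → V₁ ⊕ V₂
  | (.inl (.inl e), b) => .inl (t₁ (e, b))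
  | (.inl (.inr e), b) => .inr (t₂ (e, b))
  | (.inr e, false) => .inl (a₁ e)
  | (.inr e, true) => .inr (a₂ e)

/-- Sort the half-edges by the parts to which their edges belong. -/
def glueEquiv (E₁ E₂ E₃ : Type*) :
    ((E₁ × Bool) ⊕ (E₂ × Bool)) ⊕ (E₃ × Bool) ≃ ((E₁ ⊕ E₂) ⊕ E₃) × Bool where
  toFun
    | .inl (.inl (e, b)) => (.inl (.inl e), b)
    | .inl (.inr (e, b)) => (.inl (.inr e), b)
    | .inr (e, b) => (.inr e, b)
  invFun
    | (.inl (.inl e), b) => .inl (.inl (e, b))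
    | (.inl (.inr e), b) => .inl (.inr (e, b))
    | (.inr e, b) => .inr (e, b)
  left_inv := by rintro ((⟨e, b⟩ | ⟨e, b⟩) | ⟨e, b⟩) <;> rfl
  right_inv := by rintro ⟨(e | e) | e, b⟩ <;> rfl

/-- The number of faces of the rotation system with rotation `σ` whose half-edges are attached
by `t`. -/
noncomputable def numFaces {E V : Type*} (t : E × Bool → V) (σ : Perm (E × Bool)) : ℕ :=
  (σ * rev E).numOrbits + Nat.card {v // ∀ d, t d ≠ v}

variable [Finite E₁] [Finite E₂] [Finite E₃] [Finite V₁] [Finite V₂]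

/-- Two rotation systems can be joined by arbitrary edges between them so that the number of faces
is at most the sum of the numbers of faces of the two parts. -/
theorem exists_glue {t₁ : E₁ × Bool → V₁} {t₂ : E₂ × Bool → V₂} (a₁ : E₃ → V₁) (a₂ : E₃ → V₂)
    {σ₁ : Perm (E₁ × Bool)} {σ₂ : Perm (E₂ × Bool)}
    (h₁ : ∀ d d', σ₁.SameCycle d d' ↔ t₁ d = t₁ d')
    (h₂ : ∀ d d', σ₂.SameCycle d d' ↔ t₂ d = t₂ d') :
    ∃ σ : Perm (((E₁ ⊕ E₂) ⊕ E₃) × Bool),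
      (∀ d d', σ.SameCycle d d' ↔ glueTail t₁ t₂ a₁ a₂ d = glueTail t₁ t₂ a₁ a₂ d') ∧
        numFaces (glueTail t₁ t₂ a₁ a₂) σ ≤ numFaces t₁ σ₁ + numFaces t₂ σ₂ := by
  classical
  have := Fintype.ofFinite E₁
  have := Fintype.ofFinite E₂
  have := Fintype.ofFinite E₃
  have := Fintype.ofFinite V₁
  set t := glueTail t₁ t₂ a₁ a₂ with ht
  let S : Finset ((E₁ ⊕ E₂) ⊕ E₃) := Finset.univ.map Function.Embedding.inl
  let A : Finset ((E₁ ⊕ E₂) ⊕ E₃) := Finset.univ.map Function.Embedding.inr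
  let W : Finset (V₁ ⊕ V₂) := Finset.univ.map Function.Embedding.inl
  have hS : ∀ e, e ∈ S ↔ e.isLeft := by rintro (e | e) <;> simp [S]
  have hA : ∀ e, e ∈ A ↔ e.isRight := by rintro (e | e) <;> simp [A]
  have hW : ∀ v, v ∈ W ↔ v.isLeft := by rintro (e | e) <;> simp [W]
  have hSA : S ∪ A = Finset.univ := by
    ext (e | e) <;> simp [hS, hA]
  have hdis : Disjoint S A := by
    rw [Finset.disjoint_left]
    rintro (e | e) <;> simp [hS, hA]
  let σ₀ : Perm (((E₁ ⊕ E₂) ⊕ E₃) × Bool) :=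
    (glueEquiv E₁ E₂ E₃).permCongr (Perm.sumCongr (Perm.sumCongr σ₁ σ₂) 1)
  -- The edges of `E₃` are not yet in `S`, so their half-edges stay fixed. These `2|E₃|` extra
  -- orbits cancel against the growth of `2 * S.card` in `faceCount`.
  let τ₀ : Perm (((E₁ ⊕ E₂) ⊕ E₃) × Bool) :=
    (glueEquiv E₁ E₂ E₃).permCongr (Perm.sumCongr (Perm.sumCongr (rev E₁) (rev E₂)) 1)
  obtain ⟨ρ, hρ, hc⟩ := exists_isRotation (t := t) (S := S) (σ := σ₀)
    (by
      rintro (e | e) he b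
      · simp [hS] at he
      · rfl)
    (by
      rintro ((e | e) | e) he b ((e' | e') | e') he' b'
      · refine (sameCycle_permCongr (e := glueEquiv E₁ E₂ E₃) (x := .inl (.inl (e, b)))
          (y := .inl (.inl (e', b')))).trans ?_
        rw [sameCycle_sumCongr_inl, sameCycle_sumCongr_inl, h₁]
        simp [ht, glueTail]
      · refine (sameCycle_permCongr (e := glueEquiv E₁ E₂ E₃) (x := .inl (.inl (e, b)))
          (y := .inl (.inr (e', b')))).trans ?_
        rw [sameCycle_sumCongr_inl]
        simp [ht, glueTail, not_sameCycle_sumCongr]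
      · simp [hS] at he'
      · refine (sameCycle_permCongr (e := glueEquiv E₁ E₂ E₃) (x := .inl (.inr (e, b)))
          (y := .inl (.inl (e', b')))).trans ?_
        rw [sameCycle_sumCongr_inl, sameCycle_comm]
        simp [ht, glueTail, not_sameCycle_sumCongr]
      · refine (sameCycle_permCongr (e := glueEquiv E₁ E₂ E₃) (x := .inl (.inr (e, b)))
          (y := .inl (.inr (e', b')))).trans ?_
        rw [sameCycle_sumCongr_inl, sameCycle_sumCongr_inr, h₂]
        simp [ht, glueTail]
      · simp [hS] at he'
      all_goals simp [hS] at he)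
  have hτ : ∀ d, flip S (.inl d) = (.inl (τ₀ d) : MarkedDart ((E₁ ⊕ E₂) ⊕ E₃) (V₁ ⊕ V₂)) := by
    rintro ⟨(e | e) | e, b⟩
    · rw [flip_of_mem (by simp [hS])]; rfl
    · rw [flip_of_mem (by simp [hS])]; rfl
    · rw [flip_of_notMem (by simp [hS])]; rfl
  have hcount := hρ.numOrbits_face hc hτ
  have hmul : σ₀ * τ₀ = (glueEquiv E₁ E₂ E₃).permCongr
      (Perm.sumCongr (Perm.sumCongr (σ₁ * rev E₁) (σ₂ * rev E₂)) 1) := by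
    ext1 ⟨(e | e) | e, b⟩ <;> rfl
  rw [hmul, numOrbits_permCongr, numOrbits_sumCongr, numOrbits_sumCongr, numOrbits_one,
    Nat.card_prod, Nat.card_eq_fintype_card (α := Bool), Fintype.card_bool] at hcount
  have hiso : Nat.card {v // ∀ e ∈ S, ∀ b, t (e, b) ≠ v} =
      Nat.card {v // ∀ d, t₁ d ≠ v} + Nat.card {v // ∀ d, t₂ d ≠ v} := by
    rw [← Nat.card_sum]
    refine Nat.card_congr (Equiv.subtypeSum.trans (Equiv.sumCongr
      (Equiv.subtypeEquivRight fun v => ?_) (Equiv.subtypeEquivRight fun v => ?_)))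
    · refine ⟨fun h d hd => h (.inl (.inl d.1)) (by simp [hS]) d.2 (by rw [← hd]; rfl), ?_⟩
      rintro h ((e | e) | e) he b
      · simpa [ht, glueTail] using h (e, b)
      · simp [ht, glueTail]
      · simp [hS] at he
    · refine ⟨fun h d hd => h (.inl (.inr d.1)) (by simp [hS]) d.2 (by rw [← hd]; rfl), ?_⟩
      rintro h ((e | e) | e) he b
      · simp [ht, glueTail]
      · simpa [ht, glueTail] using h (e, b)
      · simp [hS] at he
  obtain ⟨ρ', hρ', hle⟩ := exists_isRotation_union _ W S A ρ rfl hρ hdis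
    (by rintro ((e | e) | e) he b <;> simp [hW, hS, ht, glueTail] at he ⊢)
    (by rintro ((e | e) | e) he (_ | _) <;> simp [hW, hA, ht, glueTail] at he ⊢)
  have hcard : (S ∪ A).card = S.card + Nat.card E₃ := by
    rw [Finset.card_union_of_disjoint hdis, Finset.card_map, Finset.card_map, Finset.card_univ,
      Finset.card_univ, Nat.card_eq_fintype_card]
  rw [faceCount, faceCount, hcard] at hle
  rw [hSA] at hρ' hle
  obtain ⟨σ, hσ⟩ := hρ'.exists_isContraction
  have hτ' : ∀ d, flip Finset.univ (.inl d) =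
      (.inl (rev _ d) : MarkedDart ((E₁ ⊕ E₂) ⊕ E₃) (V₁ ⊕ V₂)) :=
    fun d => flip_of_mem (Finset.mem_univ _) _
  have hcount' := hρ'.numOrbits_face hσ hτ'
  have hiso' : Nat.card {v // ∀ e ∈ (Finset.univ : Finset ((E₁ ⊕ E₂) ⊕ E₃)), ∀ b, t (e, b) ≠ v} =
      Nat.card {v // ∀ d, t d ≠ v} :=
    Nat.card_congr (Equiv.subtypeEquivRight fun v => by simp)
  refine ⟨σ, fun d d' => ?_, ?_⟩
  · rw [← hσ.sameCycle_iff]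
    constructor
    · exact fun h => h.eq_of_invariant (f := vert t) hρ'.vert_apply
    · intro h
      refine (hρ'.sameCycle d.1 (Finset.mem_univ _) d.2).trans ?_
      change t (d.1, d.2) = t (d'.1, d'.2) at h
      rw [h]
      exact (hρ'.sameCycle d'.1 (Finset.mem_univ _) d'.2).symm
  · rw [numFaces, numFaces, numFaces]
    omega

end Glue

/-- Euler's formula modulo 2. -/
theorem even_card_add_card_add_numFaces {E V : Type*} [Finite E] [Finite V] {t : E × Bool → V}
    {σ : Perm (E × Bool)} (h : ∀ d d', σ.SameCycle d d' ↔ t d = t d') :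
    Even (Nat.card V + Nat.card E + numFaces t σ) := by
  classical
  have := Fintype.ofFinite E
  -- The orbits of `σ` are the non-isolated vertices and those of `rev E` the edges, so
  -- multiplicativity of the sign relates the parities of vertices, edges and faces.
  have h1 : σ.numOrbits + Nat.card {v // ∀ d, t d ≠ v} = Nat.card V := by
    have e1 : σ.numOrbits = Nat.card {v // ∃ d, t d = v} := by
      refine Nat.card_eq_of_bijective (Quotient.lift (fun d => ⟨t d, d, rfl⟩)
        fun d d' hd => Subtype.ext ((h d d').1 hd)) ⟨?_, ?_⟩
      · intro x y hxy
        induction x using Quotient.inductionOn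
        induction y using Quotient.inductionOn
        exact Quotient.sound ((h _ _).2 (congrArg Subtype.val hxy))
      · rintro ⟨_, d, rfl⟩
        exact ⟨Quotient.mk _ d, rfl⟩
    have e2 : Nat.card {v // ∀ d, t d ≠ v} = Nat.card {v // ¬ ∃ d, t d = v} :=
      Nat.card_congr (Equiv.subtypeEquivRight fun v => by simp)
    rw [e1, e2, ← Nat.card_sum]
    exact Nat.card_congr (Equiv.sumCompl _)
  have h2 : (rev E).numOrbits = Nat.card E := by
    refine Nat.card_eq_of_bijective (Quotient.lift (fun d => d.1)
      fun d d' hd => SameCycle.eq_of_invariant (f := Prod.fst) (fun _ => rfl) hd) ⟨?_, ?_⟩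
    · intro x y hxy
      induction x using Quotient.inductionOn with | _ x => ?_
      induction y using Quotient.inductionOn with | _ y => ?_
      obtain ⟨e, b⟩ := x
      obtain ⟨e', b'⟩ := y
      obtain rfl : e = e' := hxy
      refine Quotient.sound ?_
      by_cases hb : b' = b
      · subst hb; exact SameCycle.refl _ _
      · exact sameCycle_of_apply_eq (by rw [rev_apply, Bool.eq_not.2 hb])
    · exact fun e => ⟨Quotient.mk _ (e, true), rfl⟩
  have h3 := sign_mul σ (rev E)
  rw [sign_eq_neg_one_pow_numOrbits, sign_eq_neg_one_pow_numOrbits, sign_eq_neg_one_pow_numOrbits,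
    ← pow_add] at h3
  have h4 : Fintype.card (E × Bool) = 2 * Nat.card E := by
    rw [Fintype.card_prod, Fintype.card_bool, mul_comm, Nat.card_eq_fintype_card]
  rw [h4, h2] at h3
  have h5 : Even ((σ * rev E).numOrbits) ↔ Even (σ.numOrbits + Nat.card E) := by
    rcases Nat.even_or_odd ((σ * rev E).numOrbits) with h6 | h6 <;>
    rcases Nat.even_or_odd (σ.numOrbits + Nat.card E) with h7 | h7
    · exact iff_of_true h6 h7
    · have e1 : Even (2 * Nat.card E + (σ * rev E).numOrbits) := (even_two_mul _).add h6
      have e2 : Odd (2 * Nat.card E + σ.numOrbits + (2 * Nat.card E + Nat.card E)) := by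
        grind
      rw [e1.neg_one_pow, e2.neg_one_pow] at h3
      exact absurd h3 (by decide)
    · have e1 : Odd (2 * Nat.card E + (σ * rev E).numOrbits) := (even_two_mul _).add_odd h6
      have e2 : Even (2 * Nat.card E + σ.numOrbits + (2 * Nat.card E + Nat.card E)) := by
        grind
      rw [e1.neg_one_pow, e2.neg_one_pow] at h3
      exact absurd h3 (by decide)
    · exact iff_of_false (Nat.not_even_iff_odd.2 h6) (Nat.not_even_iff_odd.2 h7)
  rw [numFaces, ← h1]
  grind

end MarkedDart

theorem MarkedDart.numFaces_permCongr {E E' V V' : Type*} [Finite E] (ε : E ≃ E') (ν : V ≃ V')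
    {t : E × Bool → V} {t' : E' × Bool → V'} (ht : ∀ e b, t' (ε e, b) = ν (t (e, b)))
    (σ : Perm (E × Bool)) :
    numFaces t' ((ε.prodCongr (Equiv.refl Bool)).permCongr σ) = numFaces t σ := by
  have h : (ε.prodCongr (Equiv.refl Bool)).permCongr σ * rev E' =
      (ε.prodCongr (Equiv.refl Bool)).permCongr (σ * rev E) := by
    ext1 ⟨e, b⟩
    rfl
  rw [numFaces, numFaces, h, numOrbits_permCongr]
  congr 1
  refine (Nat.card_congr (ν.subtypeEquiv fun v => ⟨fun h => ?_, fun h => ?_⟩)).symm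
  · rintro ⟨e, b⟩ heb
    obtain ⟨e, rfl⟩ := ε.surjective e
    exact h (e, b) (ν.injective ((ht e b).symm.trans heb))
  · rintro ⟨e, b⟩ heb
    exact h (ε e, b) (by rw [ht, heb])

/-! ### Translation to graphs and their rotation systems. -/

namespace Graph

variable {α β : Type*} {G G₁ G₂ H K L : Graph α β}

open MarkedDart

namespace RotationSystem

theorem tail_mem (R : G.RotationSystem) (d : G.Dart) : R.tail d ∈ V(G) := by
  obtain ⟨e, _ | _⟩ := d
  · exact (R.isLink_tail e).left_mem
  · exact (R.isLink_tail e).right_mem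

/-- The attachment of the half-edges to the vertices of `G`. -/
def tailVert (R : G.RotationSystem) (d : G.Dart) : V(G) := ⟨R.tail d, R.tail_mem d⟩

theorem sameCycle_rot_iff_tailVert (R : G.RotationSystem) (d d' : G.Dart) :
    R.rot.SameCycle d d' ↔ R.tailVert d = R.tailVert d' := by
  rw [R.sameCycle_rot_iff, tailVert, tailVert, Subtype.mk.injEq]

theorem card_face [Finite V(G)] [Finite E(G)] (R : G.RotationSystem) :
    Nat.card R.Face = numFaces R.tailVert R.rot := by
  rw [Face, Nat.card_sum]
  refine congrArg₂ _ rfl (Nat.card_congr (Equiv.subtypeEquivRight fun v => ?_))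
  simp [tailVert, Subtype.ext_iff]

theorem even_ncard_add_card_face [Finite V(G)] [Finite E(G)] (R : G.RotationSystem) :
    Even (V(G).ncard + E(G).ncard + Nat.card R.Face) := by
  rw [card_face, ← Nat.card_coe_set_eq, ← Nat.card_coe_set_eq]
  exact even_card_add_card_add_numFaces R.sameCycle_rot_iff_tailVert

theorem card_face_pos [Finite V(G)] [Finite E(G)] (R : G.RotationSystem) (h : V(G).Nonempty) :
    0 < Nat.card R.Face := by
  have : Finite R.Face := by unfold Face; infer_instance
  have : Nonempty R.Face := by
    obtain ⟨v, hv⟩ := h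
    by_cases hd : ∃ d, R.tail d = v
    · exact ⟨.inl (Quotient.mk _ hd.choose)⟩
    · exact ⟨.inr ⟨⟨v, hv⟩, not_exists.1 hd⟩⟩
  exact Nat.card_pos

end RotationSystem

/-- Rotation systems of two disjoint subgraphs of `G` that cover all vertices of `G`, and all edges
but those in a set `A` of edges that join the two subgraphs, can be joined to a rotation system
of `G` so that the number of faces does not exceed the sum of the numbers of faces of the parts. -/
theorem exists_rotationSystem_card_face_le [Finite V(G)] [Finite E(G)] {A : Set β}
    (hG₁ : G₁ ≤ G) (hG₂ : G₂ ≤ G) (hV : V(G₁) ∪ V(G₂) = V(G)) (hVd : Disjoint V(G₁) V(G₂))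
    (hE : E(G₁) ∪ E(G₂) ∪ A = E(G)) (hEd : Disjoint E(G₁) E(G₂)) (hAd : Disjoint (E(G₁) ∪ E(G₂)) A)
    (hA : ∀ e ∈ A, ∃ x ∈ V(G₁), ∃ y ∈ V(G₂), G.IsLink e x y)
    (R₁ : G₁.RotationSystem) (R₂ : G₂.RotationSystem) :
    ∃ R : G.RotationSystem, Nat.card R.Face ≤ Nat.card R₁.Face + Nat.card R₂.Face := by
  have hE₁ : E(G₁) ⊆ E(G) := hE ▸ Set.subset_union_left.trans Set.subset_union_left
  have hE₂ : E(G₂) ⊆ E(G) := hE ▸ Set.subset_union_right.trans Set.subset_union_left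
  have hE₃ : A ⊆ E(G) := hE ▸ Set.subset_union_right
  have hV₁ : V(G₁) ⊆ V(G) := hV ▸ Set.subset_union_left
  have hV₂ : V(G₂) ⊆ V(G) := hV ▸ Set.subset_union_right
  have : Finite E(G₁) := Finite.Set.subset _ hE₁
  have : Finite E(G₂) := Finite.Set.subset _ hE₂
  have : Finite A := Finite.Set.subset _ hE₃
  have : Finite V(G₁) := Finite.Set.subset _ hV₁
  have : Finite V(G₂) := Finite.Set.subset _ hV₂
  let ε : (E(G₁) ⊕ E(G₂)) ⊕ A ≃ E(G) := Equiv.ofBijective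
    (Sum.elim (Sum.elim (Set.inclusion hE₁) (Set.inclusion hE₂)) (Set.inclusion hE₃)) <| by
    constructor
    · rintro ((⟨x, hx⟩ | ⟨x, hx⟩) | ⟨x, hx⟩) ((⟨y, hy⟩ | ⟨y, hy⟩) | ⟨y, hy⟩) hxy <;>
        obtain rfl : x = y := congrArg Subtype.val hxy
      · rfl
      · exact absurd hy (Set.disjoint_left.1 hEd hx)
      · exact absurd hy (Set.disjoint_left.1 hAd (.inl hx))
      · exact absurd hx (Set.disjoint_left.1 hEd hy)
      · rfl
      · exact absurd hy (Set.disjoint_left.1 hAd (.inr hx))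
      · exact absurd hx (Set.disjoint_left.1 hAd (.inl hy))
      · exact absurd hx (Set.disjoint_left.1 hAd (.inr hy))
      · rfl
    · rintro ⟨x, hx⟩
      rcases hE ▸ hx with (h | h) | h
      · exact ⟨.inl (.inl ⟨x, h⟩), rfl⟩
      · exact ⟨.inl (.inr ⟨x, h⟩), rfl⟩
      · exact ⟨.inr ⟨x, h⟩, rfl⟩
  let ν : V(G₁) ⊕ V(G₂) ≃ V(G) := Equiv.ofBijective
    (Sum.elim (Set.inclusion hV₁) (Set.inclusion hV₂)) <| by
    constructor
    · rintro (⟨x, hx⟩ | ⟨x, hx⟩) (⟨y, hy⟩ | ⟨y, hy⟩) hxy <;>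
        obtain rfl : x = y := congrArg Subtype.val hxy
      · rfl
      · exact absurd hy (Set.disjoint_left.1 hVd hx)
      · exact absurd hx (Set.disjoint_left.1 hVd hy)
      · rfl
    · rintro ⟨x, hx⟩
      rcases hV ▸ hx with h | h
      · exact ⟨.inl ⟨x, h⟩, rfl⟩
      · exact ⟨.inr ⟨x, h⟩, rfl⟩
  choose a₁ ha₁ a₂ ha₂ ha using hA
  obtain ⟨σ, hσ, hle⟩ := exists_glue (E₃ := A) (fun e => ⟨a₁ e e.2, ha₁ e e.2⟩)
    (fun e => ⟨a₂ e e.2, ha₂ e e.2⟩) R₁.sameCycle_rot_iff_tailVert R₂.sameCycle_rot_iff_tailVert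
  set t := glueTail R₁.tailVert R₂.tailVert (fun e : A => ⟨a₁ e e.2, ha₁ e e.2⟩)
    (fun e : A => ⟨a₂ e e.2, ha₂ e e.2⟩) with ht
  let δ := ε.prodCongr (Equiv.refl Bool)
  let R : G.RotationSystem :=
    { tail := fun d => (ν (t (δ.symm d)) : α)
      isLink_tail := by
        intro e
        obtain ⟨x, rfl⟩ := ε.surjective e
        have h : ∀ b, δ.symm (ε x, b) = (x, b) := fun b => δ.symm_apply_apply (x, b)
        rw [h, h]
        rcases x with (e | e) | e
        · exact (R₁.isLink_tail e).mono hG₁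
        · exact (R₂.isLink_tail e).mono hG₂
        · exact ha e e.2
      rot := δ.permCongr σ
      sameCycle_rot_iff := by
        intro d d'
        obtain ⟨d, rfl⟩ := δ.surjective d
        obtain ⟨d', rfl⟩ := δ.surjective d'
        rw [sameCycle_permCongr, hσ, Equiv.symm_apply_apply, Equiv.symm_apply_apply,
          Subtype.coe_inj, ν.apply_eq_iff_eq] }
  refine ⟨R, ?_⟩
  rw [R.card_face, R₁.card_face, R₂.card_face]
  refine le_of_eq_of_le (numFaces_permCongr ε ν (t := t) (fun e b => ?_) σ) hle
  refine Subtype.ext ?_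
  change (ν (t (δ.symm (δ (e, b)))) : α) = _
  rw [Equiv.symm_apply_apply]

section Components

/-- With `isComponent_induce`, this makes the reachability class of `x` the only component through
`x`. -/
theorem le_induce_of_isConnected {x : α} (hK : K ≤ H) (hc : K.IsConnected) (hx : x ∈ V(K)) :
    K ≤ H.induce {y | y ∈ V(H) ∧ Relation.ReflTransGen H.Adj x y} := by
  have hsub : ∀ y ∈ V(K), y ∈ V(H) ∧ Relation.ReflTransGen H.Adj x y := fun y hy =>
    ⟨hK.vertexSet_mono hy, Relation.ReflTransGen.mono (fun _ _ h => Adj.mono hK h) _ _ (hc.2 hx hy)⟩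
  refine ⟨hsub, fun e y z h => ?_⟩
  exact ⟨h.mono hK, hsub y h.left_mem, hsub z h.right_mem⟩

theorem isComponent_induce {x : α} (hx : x ∈ V(H)) :
    (H.induce {y | y ∈ V(H) ∧ Relation.ReflTransGen H.Adj x y}).IsComponent H := by
  set X := {y | y ∈ V(H) ∧ Relation.ReflTransGen H.Adj x y} with hX
  have hxX : x ∈ X := ⟨hx, .refl⟩
  have hreach : ∀ y, Relation.ReflTransGen H.Adj x y →
      Relation.ReflTransGen (H.induce X).Adj x y := by
    intro y hy
    induction hy with
    | refl => exact .refl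
    | tail hy hyz ih =>
      obtain ⟨e, he⟩ := hyz
      exact ih.tail ⟨e, he, ⟨he.left_mem, hy⟩, ⟨he.right_mem, hy.tail ⟨e, he⟩⟩⟩
  refine ⟨⟨induce_le fun y hy => hy.1, ⟨x, hxX⟩, fun y hy z hz => ?_⟩, fun K hK hle => ?_⟩
  · have : Std.Symm (H.induce X).Adj := ⟨fun _ _ h => h.symm⟩
    exact (Relation.ReflTransGen.stdSymm.symm _ _ (hreach y hy.2)).trans (hreach z hz.2)
  · exact le_induce_of_isConnected hK.1 hK.2 (hle.vertexSet_mono hxX)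

theorem IsComponent.eq_induce {x : α} (h : L.IsComponent H) (hx : x ∈ V(L)) :
    L = H.induce {y | y ∈ V(H) ∧ Relation.ReflTransGen H.Adj x y} :=
  h.eq_of_le (isComponent_induce (h.prop.1.vertexSet_mono hx)).prop
    (le_induce_of_isConnected h.prop.1 h.prop.2 hx)

theorem IsComponent.isLink {x y : α} {e : β} (h : L.IsComponent H) (hx : x ∈ V(L))
    (he : H.IsLink e x y) : L.IsLink e x y := by
  rw [h.eq_induce hx]
  exact ⟨he, ⟨he.left_mem, .refl⟩, ⟨he.right_mem, .single ⟨e, he⟩⟩⟩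

theorem IsConnected.mem_of_mem {S : Set α} (hL : L.IsConnected)
    (hS : ∀ x y, L.Adj x y → x ∈ S → y ∈ S) {x y : α} (hx : x ∈ V(L)) (hy : y ∈ V(L))
    (hxS : x ∈ S) : y ∈ S := by
  have h := hL.2 hx hy
  induction h with
  | refl => exact hxS
  | tail _ hyz ih => exact hS _ _ hyz (ih hyz.left_mem)

variable {A : Set β}

/-- If the deletion of an edge-cut `A` leaves two components, then these partition the vertices and
the edges outside `A`, and `A` consists of edges between them. -/
theorem IsEdgeCut.partition_of_components (hG : G.IsConnected) (hA : G.IsEdgeCut A)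
    (hne : G₁ ≠ G₂) (hcomp : {H : Graph α β | H.IsComponent (G.deleteEdges A)} = {G₁, G₂}) :
    (G₁ ≤ G ∧ G₂ ≤ G) ∧ V(G₁) ∪ V(G₂) = V(G) ∧ Disjoint V(G₁) V(G₂) ∧
      E(G₁) ∪ E(G₂) ∪ A = E(G) ∧ Disjoint E(G₁) E(G₂) ∧ Disjoint (E(G₁) ∪ E(G₂)) A ∧
      A.Nonempty ∧ ∀ e ∈ A, ∃ x ∈ V(G₁), ∃ y ∈ V(G₂), G.IsLink e x y := by
  set H := G.deleteEdges A with hH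
  have hHG : H ≤ G := deleteEdges_le
  have hHV : V(H) = V(G) := rfl
  have hHE : E(H) = E(G) \ A := by simp [hH]
  have hlink : ∀ e x y, H.IsLink e x y ↔ G.IsLink e x y ∧ e ∉ A := by
    intro e x y
    rw [hH, deleteEdges_isLink]
  have h₁ : G₁.IsComponent H := hcomp.ge (Set.mem_insert _ _)
  have h₂ : G₂.IsComponent H := hcomp.ge (Set.mem_insert_of_mem _ rfl)
  have hVd : Disjoint V(G₁) V(G₂) := Set.disjoint_left.2 fun x hx hx' =>
    hne ((h₁.eq_induce hx).trans (h₂.eq_induce hx').symm)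
  have hVH : ∀ x ∈ V(H), x ∈ V(G₁) ∨ x ∈ V(G₂) := by
    intro x hx
    have hmem : x ∈ V(H.induce {y | y ∈ V(H) ∧ Relation.ReflTransGen H.Adj x y}) := ⟨hx, .refl⟩
    rcases hcomp.le (isComponent_induce hx) with h | h
    · exact .inl (h ▸ hmem)
    · exact .inr (h ▸ hmem)
  have hV : V(G₁) ∪ V(G₂) = V(G) := by
    refine Set.Subset.antisymm (Set.union_subset (h₁.prop.1.vertexSet_mono)
      (h₂.prop.1.vertexSet_mono)) fun x hx => hVH x hx
  have hEd : Disjoint E(G₁) E(G₂) := by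
    refine Set.disjoint_left.2 fun e he he' => ?_
    obtain ⟨x, y, hxy⟩ := exists_isLink_of_mem_edgeSet he
    obtain ⟨z, w, hzw⟩ := exists_isLink_of_mem_edgeSet he'
    rcases (hxy.mono h₁.prop.1).left_eq_or_eq (hzw.mono h₂.prop.1) with rfl | rfl
    · exact Set.disjoint_left.1 hVd hxy.left_mem hzw.left_mem
    · exact Set.disjoint_left.1 hVd hxy.left_mem hzw.right_mem
  have hEH : E(G₁) ∪ E(G₂) = E(G) \ A := by
    rw [← hHE]
    refine Set.Subset.antisymm (Set.union_subset (h₁.prop.1.edgeSet_mono)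
      (h₂.prop.1.edgeSet_mono)) fun e he => ?_
    obtain ⟨x, y, hxy⟩ := exists_isLink_of_mem_edgeSet he
    rcases hVH x hxy.left_mem with hx | hx
    · exact .inl (h₁.isLink hx hxy).edge_mem
    · exact .inr (h₂.isLink hx hxy).edge_mem
  obtain ⟨S, hSV, ⟨s, hs⟩, ⟨s', hs', hs'S⟩, rfl⟩ := hA
  set A := {e | ∃ x ∈ S, ∃ y ∈ V(G) \ S, G.IsLink e x y} with hA
  have hAE : A ⊆ E(G) := by
    rintro e ⟨x, -, y, -, h⟩
    exact h.edge_mem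
  have hclosed : ∀ x y, H.Adj x y → x ∈ S → y ∈ S := by
    rintro x y ⟨e, he⟩ hx
    obtain ⟨he, heA⟩ := (hlink e x y).1 he
    by_contra hy
    exact heA ⟨x, hx, y, ⟨he.right_mem, hy⟩, he⟩
  have hside : ∀ L : Graph α β, L.IsComponent H → ∀ x ∈ V(L), ∀ y ∈ V(L), x ∈ S → y ∈ S :=
    fun L hL x hx y hy => hL.prop.2.mem_of_mem
      (fun x y h => hclosed x y (h.mono hL.prop.1)) hx hy
  have hAne : A.Nonempty := by
    by_contra hemp
    rw [Set.not_nonempty_iff_eq_empty] at hemp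
    refine hs'S (hG.mem_of_mem (S := S) ?_ (hSV hs) hs' hs)
    rintro x y ⟨e, he⟩
    exact hclosed x y ⟨e, (hlink e x y).2 ⟨he, by simp [hemp]⟩⟩
  refine ⟨⟨h₁.prop.1.trans hHG, h₂.prop.1.trans hHG⟩, hV, hVd, ?_, hEd, ?_, hAne, ?_⟩
  · rw [hEH, Set.sdiff_union_of_subset hAE]
  · rw [hEH]
    exact Set.disjoint_sdiff_left
  · rintro e ⟨x, hx, y, ⟨hy, hyS⟩, he⟩
    -- `S` is a union of vertex sets of components. Both `S` and its complement are nonempty, so `S`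
    -- is exactly one of `V(G₁)` and `V(G₂)`.
    have hopp : ∀ z ∈ V(G₁), ∀ w ∈ V(G₂), z ∈ S ↔ w ∉ S := by
      intro z hz w hw
      rcases hVH s (hSV hs) with h3 | h3 <;> rcases hVH s' hs' with h4 | h4
      · exact absurd (hside _ h₁ s h3 s' h4 hs) hs'S
      · exact iff_of_true (hside _ h₁ s h3 z hz hs)
          (fun h5 => hs'S (hside _ h₂ w hw s' h4 h5))
      · exact iff_of_false (fun h5 => hs'S (hside _ h₁ z hz s' h4 h5))
          (not_not.2 (hside _ h₂ s h3 w hw hs))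
      · exact absurd (hside _ h₂ s h3 s' h4 hs) hs'S
    rcases hVH x (hSV hx) with h3 | h3 <;> rcases hVH y hy with h4 | h4
    · exact absurd (hside _ h₁ x h3 y h4 hx) hyS
    · exact ⟨x, h3, y, h4, he⟩
    · exact ⟨y, h4, x, h3, he.symm⟩
    · exact absurd (hside _ h₂ x h3 y h4 hx) hyS

end Components

/-- A genus of `G` is at most half the Betti number. -/
theorem RotationSystem.HasGenus.le_betti_div_two (hV : V(G).Finite) (hE : E(G).Finite)
    (hne : V(G).Nonempty) {R : G.RotationSystem} {k : ℕ} (h : R.HasGenus k) :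
    (k : ℤ) ≤ G.betti / 2 := by
  have := hV.to_subtype
  have := hE.to_subtype
  have hpos := R.card_face_pos hne
  rw [HasGenus] at h
  rw [betti]
  omega

theorem RotationSystem.HasGenus.exists_isMaxGenus (hV : V(G).Finite) (hE : E(G).Finite)
    (hne : V(G).Nonempty) {R : G.RotationSystem} {k : ℕ} (h : R.HasGenus k) :
    ∃ g, G.IsMaxGenus g ∧ k ≤ g ∧ (g : ℤ) ≤ G.betti / 2 := by
  have hb : BddAbove {k : ℕ | ∃ R : G.RotationSystem, R.HasGenus k} := by
    refine ⟨(G.betti / 2).toNat, ?_⟩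
    rintro k ⟨R, hR⟩
    have := hR.le_betti_div_two hV hE hne
    omega
  have hmem := Nat.sSup_mem (s := {k : ℕ | ∃ R : G.RotationSystem, R.HasGenus k}) ⟨k, R, h⟩ hb
  obtain ⟨R', hR'⟩ := hmem
  exact ⟨_, ⟨⟨R', hR'⟩, fun j hj => le_csSup hb hj⟩, le_csSup hb ⟨R, h⟩,
    hR'.le_betti_div_two hV hE hne⟩

end Graph

/-! ### The theorem, by counting faces. -/

theorem theorem5 {α β : Type*} (G : Graph α β)
    (hV : V(G).Finite) (hE : E(G).Finite) (hG : G.IsConnected)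
    (A : Set β) (hA : G.IsEdgeCut A)
    (G₁ G₂ : Graph α β) (hne : G₁ ≠ G₂)
    (hcomp : {H : Graph α β | H.IsComponent (G.deleteEdges A)} = {G₁, G₂})
    (h₁ : G₁.UpperEmbeddable) (h₂ : G₂.UpperEmbeddable) :
    (∃ g : ℕ, G.IsMaxGenus g ∧ G.betti / 2 - 1 ≤ (g : ℤ)) ∧
    ((Even G₁.betti ∧ Even G₂.betti) ∨ (Odd A.ncard ∧ Odd (G₁.betti + G₂.betti)) →
      G.UpperEmbeddable) := by
  obtain ⟨⟨hG₁, hG₂⟩, hVu, hVd, hEu, hEd, hAd, hAne, hAl⟩ :=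
    hA.partition_of_components hG hne hcomp
  obtain ⟨g₁, ⟨⟨R₁, hR₁⟩, -⟩, hg₁⟩ := h₁
  obtain ⟨g₂, ⟨⟨R₂, hR₂⟩, -⟩, hg₂⟩ := h₂
  have hVfin := hV.to_subtype
  have hEfin := hE.to_subtype
  obtain ⟨R, hR⟩ :=
    Graph.exists_rotationSystem_card_face_le hG₁ hG₂ hVu hVd hEu hEd hAd hAl R₁ R₂
  have hpar := R.even_ncard_add_card_face
  have hpos := R.card_face_pos hG.1
  rw [← hVu] at hV
  rw [← hEu] at hE
  have hVc : V(G).ncard = V(G₁).ncard + V(G₂).ncard := by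
    rw [← hVu, Set.ncard_union_eq hVd (hV.subset Set.subset_union_left)
      (hV.subset Set.subset_union_right)]
  have hEc : E(G).ncard = E(G₁).ncard + E(G₂).ncard + A.ncard := by
    have hE' := hE.subset Set.subset_union_left
    rw [← hEu, Set.ncard_union_eq hAd hE' (hE.subset Set.subset_union_right),
      Set.ncard_union_eq hEd (hE'.subset Set.subset_union_left)
        (hE'.subset Set.subset_union_right)]
  have hAc : 0 < A.ncard := (Set.ncard_pos (hE.subset Set.subset_union_right)).2 hAne
  rw [hVu] at hV
  rw [hEu] at hE
  rw [Graph.RotationSystem.HasGenus] at hR₁ hR₂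
  rw [Graph.betti] at hg₁ hg₂
  rw [Nat.even_iff] at hpar
  -- The numerator is even by parity, and at least `2g₁ + 2g₂ + |A| - 2 ≥ -1` by the face bound.
  -- Hence it is nonnegative and `toNat` truncates nothing.
  obtain ⟨k, hk⟩ : ∃ k : ℕ, R.HasGenus k := by
    refine ⟨((2 - (V(G).ncard : ℤ) + E(G).ncard - Nat.card R.Face) / 2).toNat, ?_⟩
    rw [Graph.RotationSystem.HasGenus]
    omega
  obtain ⟨g, hg, hkg, hgb⟩ := hk.exists_isMaxGenus hV hE hG.1
  rw [Graph.RotationSystem.HasGenus] at hk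
  rw [Int.even_iff, Int.even_iff, Nat.odd_iff, Int.odd_iff]
  refine ⟨⟨g, hg, ?_⟩, fun h => ⟨g, hg, ?_⟩⟩
  · rw [Graph.betti] at hgb ⊢
    omega
  · rw [Graph.betti] at hgb ⊢
    rw [Graph.betti, Graph.betti] at h
    omega
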